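/- Let $K$ be a nonarchimedean local field of characteristic $p>0$ with ring of integers $\mathfrak D$, prime ideal $\mathfrak P$ and residue field $\mathfrak D/\mathfrak P$ of cardinality $q=p^c$. Let $dx$ be the Haar measure of $K^+$ with $|\mathfrak D|=1$, let $L^2(K)=L^2(K,dx)$ be the space of complex square-integrable functions, and write $\langle f,g\rangle=\int_K f\overline g\,dx$. Fix a prime element $\mathfrak p$ of $K$ and elements $1=\epsilon_0,\epsilon_1,\dots,\epsilon_{c-1}\in\mathfrak D$ whose residue classes form a basis of $\mathfrak D/\mathfrak P$ over $GF(p)$. For $0\le n<q$ with $n=a_0+a_1p+\dots+a_{c-1}p^{c-1}$, $0\le a_i<p$, put $u(n)=(a_0+a_1\epsilon_1+\dots+a_{c-1}\epsilon_{c-1})\mathfrak p^{-1}$, and for $n=b_0+b_1q+\dots+b_sq^s$, $0\le b_r<q$, put $u(n)=u(b_0)+u(b_1)\mathfrak p^{-1}+\dots+u(b_s)\mathfrak p^{-s}$. For $j\in\mathbb Z$ and $y\in K$ let $\delta_jf(x)=q^{j/2}f(\mathfrak p^{-j}x)$ and $\tau_yf(x)=f(x-y)$. For $f\in L^2(K)$,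 $j\in\mathbb Z$, $k\in\mathbb N_0$ let $f_{j,k}=\delta_j\tau_{u(k)}f$, and let $\tilde f_{j,k}=f_{j,k}$ if $j\ge0$ and $\tilde f_{j,k}=q^{j/2}\tau_{u(k)}\delta_jf$ if $j<0$. A finite family $\Psi=(\psi^1,\dots,\psi^L)$ in $L^2(K)$ generates an affine Bessel family if there is $B>0$ with $\sum_{l=1}^L\sum_{j\in\mathbb Z}\sum_{k\ge0}|\langle f,\psi^l_{j,k}\rangle|^2\le B\|f\|_2^2$ for all $f\in L^2(K)$. For $\Psi=(\psi^1,\dots,\psi^L)$ and $\Phi=(\varphi^1,\dots,\varphi^L)$ put $$K_{\Psi,\Phi}(f,g)=\sum_{l=1}^L\sum_{j\in\mathbb Z}\sum_{k\ge0}\langle f,\psi^l_{j,k}\rangle\langle\varphi^l_{j,k},g\rangle,\qquad \tilde K_{\Psi,\Phi}(f,g)=\sum_{l=1}^L\sum_{j\in\mathbb Z}\sum_{k\ge0}\langle f,\tilde\psi^l_{j,k}\rangle\langle\tilde\varphi^l_{j,k},g\rangle .$$ If $\Psi$ and $\Phi$ both generate affine Bessel families, $\Phi$ is called an affine dual of $\Psi$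 if $K_{\Psi,\Phi}(f,g)=\langle f,g\rangle$ for all $f,g\in L^2(K)$, and a quasi-affine dual of $\Psi$ if $\tilde K_{\Psi,\Phi}(f,g)=\langle f,g\rangle$ for all $f,g\in L^2(K)$; the series are understood to converge unconditionally. (Without the Bessel property of both families, $\Phi$ is neither an affine nor a quasi-affine dual of $\Psi$.) Theorem. Let $\Psi=(\psi^1,\dots,\psi^L)$ be a finite family in $L^2(K)$ that generates an affine Bessel family, and let $\Phi=(\varphi^1,\dots,\varphi^L)$ be a family in $L^2(K)$ of the same length. Then $\Phi$ is an affine dual of $\Psi$ if and only if $\Phi$ is a quasi-affine dual of $\Psi$. -/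

import Mathlib

open ValuativeRel MeasureTheory

namespace AffineDuals

section LocalField

variable (K : Type*) [Field K] [ValuativeRel K] [TopologicalSpace K] [IsNonarchimedeanLocalField K]

/-- The cardinality `q` of the residue field of the local field `K`. -/
noncomputable def residueCard : ℕ := Nat.card 𝓀[K]

/-- The ring of integers of `K`, as a compact set with nonempty interior. -/
def integersPositiveCompacts : TopologicalSpace.PositiveCompacts K where
  carrier := {x | valuation K x ≤ 1}
  isCompact' := IsNonarchimedeanLocalField.isCompact_closedBall K 1
  interior_nonempty' := by
    refine ⟨0, mem_interior_iff_mem_nhds.mpr ?_⟩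
    refine (IsValuativeTopology.hasBasis_nhds_zero' K).mem_iff.mpr ⟨1, one_ne_zero, ?_⟩
    intro x hx
    exact le_of_lt (show valuation K x < 1 from hx)

/-- The Haar measure of the additive group of `K`, normalized so that the ring of integers has
measure `1`. -/
noncomputable def haar [MeasurableSpace K] [BorelSpace K] : Measure K :=
  Measure.addHaarMeasure (integersPositiveCompacts K)

instance [MeasurableSpace K] [BorelSpace K] : (haar K).IsAddHaarMeasure :=
  inferInstanceAs (Measure.addHaarMeasure _).IsAddHaarMeasure

instance [MeasurableSpace K] [BorelSpace K] : (haar K).Regular :=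
  inferInstanceAs (Measure.addHaarMeasure _).Regular

/-- The complex Hilbert space `L²(K)`. -/
noncomputable abbrev L2 [MeasurableSpace K] [BorelSpace K] := Lp ℂ 2 (haar K)

variable {K}

/-- A prime element: an element of maximal absolute value in the prime ideal `{x | |x| < 1}`. -/
def IsPrimeElement (ϖ : K) : Prop :=
  valuation K ϖ < 1 ∧ ∀ x : K, valuation K x < 1 → valuation K x ≤ valuation K ϖ

/-- The residue classes of `ε₀, …, ε_{c-1}` form a basis of the residue field over the field with
`p` elements: every residue class can be written in exactly one way as `∑ aᵢ εᵢ` with digits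
`0 ≤ aᵢ < p`. -/
def IsResidueBasis (p : ℕ) {c : ℕ} (ε : Fin c → 𝒪[K]) : Prop :=
  Function.Bijective fun a : Fin c → Fin p =>
    ∑ i, ((a i : ℕ) : 𝓀[K]) * IsLocalRing.residue 𝒪[K] (ε i)

/-- `(a₀ + a₁ ε₁ + ⋯ + a_{c-1} ε_{c-1}) ϖ⁻¹`, where `aᵢ` is the `i`-th digit of `n` in base `p`
(used for `n < q = p ^ c`). -/
noncomputable def uDigit (p : ℕ) {c : ℕ} (ϖ : Kˣ) (ε : Fin c → 𝒪[K]) (n : ℕ) : K :=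
  (∑ i : Fin c, ((n / p ^ (i : ℕ) % p : ℕ) : K) * (ε i : K)) * (ϖ : K)⁻¹

/-- The translations `u(n) = u(b₀) + u(b₁) ϖ⁻¹ + ⋯ + u(b_s) ϖ⁻ˢ`, where `b_r` is the `r`-th digit
of `n` in base `q`; all digits of `n` of index `r > n` vanish. -/
noncomputable def u (p : ℕ) {c : ℕ} (ϖ : Kˣ) (ε : Fin c → 𝒪[K]) (n : ℕ) : K :=
  ∑ r ∈ Finset.range (n + 1),
    uDigit p ϖ ε (n / residueCard K ^ r % residueCard K) * (ϖ : K)⁻¹ ^ r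

variable [MeasurableSpace K] [BorelSpace K]

/-- The translation operator `τ_y f(x) = f(x - y)` on `L²(K)`. -/
noncomputable def translationOp (y : K) (f : L2 K) : L2 K :=
  Lp.compMeasurePreserving (fun x => x - y) (measurePreserving_sub_right (haar K) y) f

/-- Composition with multiplication by a unit preserves square integrability. -/
theorem memLp_comp_mul (a : Kˣ) {f : K → ℂ} (hf : MemLp f 2 (haar K)) :
    MemLp (fun x => f ((a : K) * x)) 2 (haar K) := by
  let e : K ≃ₜ K := Homeomorph.mulLeft₀ (a : K) a.ne_zero
  have hmap : ((haar K).map e).IsAddHaarMeasure :=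
    AddEquiv.isAddHaarMeasure_map (haar K)
      ({ e.toEquiv with map_add' := fun x y => mul_add (a : K) x y } : K ≃+ K)
      e.continuous e.symm.continuous
  have hreg : ((haar K).map e).Regular := Measure.Regular.map e
  have heq := Measure.isAddLeftInvariant_eq_smul_of_regular ((haar K).map e) (haar K)
  have h : MemLp f 2 ((haar K).map e) := by
    rw [heq]
    exact hf.smul_measure ENNReal.coe_ne_top
  exact h.comp_of_map e.continuous.aemeasurable

/-- The dilation operator `δ_j f(x) = q^{j/2} f(ϖ^{-j} x)` on `L²(K)`. -/
noncomputable def dilationOp (ϖ : Kˣ) (j : ℤ) (f : L2 K) : L2 K :=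
  (((residueCard K : ℝ) ^ ((j : ℝ) / 2) : ℝ) : ℂ) •
    (memLp_comp_mul (ϖ ^ (-j)) (Lp.memLp f)).toLp

/-- The element `f_{j,k} = δ_j τ_{u(k)} f` of the affine system generated by `f`. -/
noncomputable def affineElt (p : ℕ) {c : ℕ} (ϖ : Kˣ) (ε : Fin c → 𝒪[K]) (f : L2 K)
    (j : ℤ) (k : ℕ) : L2 K :=
  dilationOp ϖ j (translationOp (u p ϖ ε k) f)

/-- The element of the quasi-affine system generated by `f`: it is `δ_j τ_{u(k)} f` if `j ≥ 0` and
`q^{j/2} τ_{u(k)} δ_j f` if `j < 0`. -/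
noncomputable def quasiAffineElt (p : ℕ) {c : ℕ} (ϖ : Kˣ) (ε : Fin c → 𝒪[K]) (f : L2 K)
    (j : ℤ) (k : ℕ) : L2 K :=
  if 0 ≤ j then dilationOp ϖ j (translationOp (u p ϖ ε k) f)
  else (((residueCard K : ℝ) ^ ((j : ℝ) / 2) : ℝ) : ℂ) • translationOp (u p ϖ ε k) (dilationOp ϖ j f)

/-- The pairing `⟨f, g⟩ = ∫ f(x) conj(g(x)) dx`, linear in `f` (Mathlib's `inner ℂ` is linear in
its second argument). -/
noncomputable def pair (f g : L2 K) : ℂ := inner ℂ g f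

/-- The affine system generated by `Ψ = (ψ¹, …, ψᴸ)` is a Bessel family. -/
def IsAffineBessel (p : ℕ) {c : ℕ} (ϖ : Kˣ) (ε : Fin c → 𝒪[K]) {L : ℕ} (Ψ : Fin L → L2 K) :
    Prop :=
  ∃ B : ℝ, 0 < B ∧ ∀ f : L2 K,
    Summable (fun i : Fin L × ℤ × ℕ => ‖pair f (affineElt p ϖ ε (Ψ i.1) i.2.1 i.2.2)‖ ^ 2) ∧
    ∑' i : Fin L × ℤ × ℕ, ‖pair f (affineElt p ϖ ε (Ψ i.1) i.2.1 i.2.2)‖ ^ 2 ≤ B * ‖f‖ ^ 2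

/-- The terms `⟨f, ψˡ_{j,k}⟩ ⟨φˡ_{j,k}, g⟩` of the series `K_{Ψ,Φ}(f, g)`. -/
noncomputable def affineTerm (p : ℕ) {c : ℕ} (ϖ : Kˣ) (ε : Fin c → 𝒪[K]) {L : ℕ}
    (Ψ Φ : Fin L → L2 K) (f g : L2 K) (i : Fin L × ℤ × ℕ) : ℂ :=
  pair f (affineElt p ϖ ε (Ψ i.1) i.2.1 i.2.2) * pair (affineElt p ϖ ε (Φ i.1) i.2.1 i.2.2) g

/-- The terms of the series `K̃_{Ψ,Φ}(f, g)` belonging to the quasi-affine systems. -/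
noncomputable def quasiAffineTerm (p : ℕ) {c : ℕ} (ϖ : Kˣ) (ε : Fin c → 𝒪[K]) {L : ℕ}
    (Ψ Φ : Fin L → L2 K) (f g : L2 K) (i : Fin L × ℤ × ℕ) : ℂ :=
  pair f (quasiAffineElt p ϖ ε (Ψ i.1) i.2.1 i.2.2) *
    pair (quasiAffineElt p ϖ ε (Φ i.1) i.2.1 i.2.2) g

/-- `Φ` is an affine dual of `Ψ`: both affine systems are Bessel families, and
`K_{Ψ,Φ}(f, g) = ⟨f, g⟩` for all `f, g`. -/
def IsAffineDual (p : ℕ) {c : ℕ} (ϖ : Kˣ) (ε : Fin c → 𝒪[K]) {L : ℕ} (Ψ Φ : Fin L → L2 K) :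
    Prop :=
  IsAffineBessel p ϖ ε Ψ ∧ IsAffineBessel p ϖ ε Φ ∧
    ∀ f g : L2 K, HasSum (affineTerm p ϖ ε Ψ Φ f g) (pair f g)

/-- `Φ` is a quasi-affine dual of `Ψ`: both affine systems are Bessel families, and
`K̃_{Ψ,Φ}(f, g) = ⟨f, g⟩` for all `f, g`. -/
def IsQuasiAffineDual (p : ℕ) {c : ℕ} (ϖ : Kˣ) (ε : Fin c → 𝒪[K]) {L : ℕ}
    (Ψ Φ : Fin L → L2 K) : Prop :=
  IsAffineBessel p ϖ ε Ψ ∧ IsAffineBessel p ϖ ε Φ ∧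
    ∀ f g : L2 K, HasSum (quasiAffineTerm p ϖ ε Ψ Φ f g) (pair f g)

end LocalField

end AffineDuals

namespace AffineDuals

set_option linter.unusedSectionVars false

/-! ### The translation set Λ = {u(n)}: group structure, digit shifts, and cosets of the ring of
integers. -/

section Arithmetic

variable {K : Type*} [Field K] [ValuativeRel K] [TopologicalSpace K] [IsNonarchimedeanLocalField K]
  {p : ℕ} {c : ℕ} {ϖ : Kˣ} {ε : Fin c → 𝒪[K]}

/-! Write Λ = {u(n)} and 𝔇 for the ring of integers. Since p = 0 in K, Λ is a subgroup of K⁺; it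
meets every coset of 𝔇 exactly once; and u(a + q^m b) = u(a) + ϖ^(-m) u(b) for a < q^m, so ϖ^(-m)Λ
has index q^m in Λ. At scale j the affine system translates δ_j ψ along ϖ^j Λ. At j = -m < 0 the
quasi-affine system translates along all of Λ, and its weight q^(j/2) compensates for the q^m-fold
oversampling. Hence, on the scales j ≥ -N, a quasi-affine sum is exactly the average over a < q^N of
the affine sums for f and g translated by -u(a) (`tsum_quasiAffine_eq_average`,
`crossSum_quasiAffine_eq_average`). In particular the quasi-affine system inherits the Bessel bound
(`BesselBound.quasiAffine`), both forms are bounded, and it suffices to test them on functions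
supported in one coset u(b) + 𝔇 (`crossSum_eq_inner_of_cosetFunctions`).

From affine to quasi-affine: averaging the affine identity over the translates shows that the
quasi-affine form truncated to j ≥ -N misses ⟨f, g⟩ by an average of affine sums over j < -N. The
translate a = b costs at most B‖f‖². The others lie in N shells according to |u(a) - u(b)|, and
within one shell the ultrametric inequality makes all the regions where a generator is tested
disjoint (`shell_index_unique`), so a shell costs at most ‖f‖² Σ‖ψ^l‖². The total grows linearly in
N and is divided by q^N (`tendsto_average_energy`).

From quasi-affine to affine: the systems agree for j ≥ 0, and the unitary δ_N moves the affine
scales j ≥ -N to j ≥ 0. The truncated affine form thus misses ⟨f, g⟩ by the negative-scale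
quasi-affine sum for δ_N f, δ_N g. This tends to 0 by dominated convergence: the weights q^j are
summable over j < 0, the relevant regions are disjoint in k, and they shrink to points as N grows
(`tendsto_energy_quasiAffine_dilationOp`). -/

theorem residueCard_eq_pow (hε : IsResidueBasis p ε) : residueCard K = p ^ c := by
  rw [residueCard, ← Nat.card_eq_of_bijective _ hε]
  simp

variable (K) in
theorem one_lt_residueCard : 1 < residueCard K := Finite.one_lt_card

theorem residue_eq_residue_iff (x y : 𝒪[K]) :
    IsLocalRing.residue 𝒪[K] x = IsLocalRing.residue 𝒪[K] y ↔ valuation K ((x : K) - y) < 1 := by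
  rw [← sub_eq_zero, ← map_sub, IsLocalRing.residue_eq_zero_iff, IsLocalRing.mem_maximalIdeal,
    mem_nonunits_iff, Valuation.Integers.isUnit_iff_valuation_eq_one (Valuation.integer.integers _)]
  have h : valuation K ((x : K) - y) ≤ 1 := (x - y).2
  exact ⟨fun h' => lt_of_le_of_ne h h', fun h' => h'.ne⟩

/-- The element `a₀ + a₁ ε₁ + ⋯` of the ring of integers attached to the digits of `n`. -/
noncomputable def digitInt (p : ℕ) (ε : Fin c → 𝒪[K]) (n : ℕ) : 𝒪[K] :=
  ∑ i : Fin c, ((n / p ^ (i : ℕ) % p : ℕ) : 𝒪[K]) * ε i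

theorem uDigit_eq (n : ℕ) : uDigit p ϖ ε n = (digitInt p ε n : K) * (ϖ : K)⁻¹ := by
  simp [uDigit, digitInt]

theorem residue_digitInt (hp : 0 < p) (n : ℕ) :
    IsLocalRing.residue 𝒪[K] (digitInt p ε n) =
      ∑ i : Fin c, (((⟨n / p ^ (i : ℕ) % p, Nat.mod_lt _ hp⟩ : Fin p) : ℕ) : 𝓀[K]) *
        IsLocalRing.residue 𝒪[K] (ε i) := by
  simp [digitInt]

theorem digitInt_of_digits (a : Fin c → Fin p) :
    ∃ n < p ^ c, digitInt p ε n = ∑ i, ((a i : ℕ) : 𝒪[K]) * ε i := by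
  refine ⟨finFunctionFinEquiv a, (finFunctionFinEquiv a).2, ?_⟩
  have := finFunctionFinEquiv.symm_apply_apply a
  refine Finset.sum_congr rfl fun i _ => ?_
  conv_rhs => rw [← this]
  simp [finFunctionFinEquiv]

theorem residue_digitInt_injOn (hp : 0 < p) (hε : IsResidueBasis p ε) {m n : ℕ}
    (hm : m < residueCard K) (hn : n < residueCard K)
    (h : IsLocalRing.residue 𝒪[K] (digitInt p ε m) = IsLocalRing.residue 𝒪[K] (digitInt p ε n)) :
    m = n := by
  rw [residue_digitInt hp, residue_digitInt hp] at h
  have h := hε.1 h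
  rw [residueCard_eq_pow hε] at hm hn
  have : finFunctionFinEquiv.symm (⟨m, hm⟩ : Fin (p ^ c)) =
      finFunctionFinEquiv.symm (⟨n, hn⟩ : Fin (p ^ c)) := by
    funext i
    have := congrArg Fin.val (congrFun h i)
    ext
    simpa [finFunctionFinEquiv] using this
  simpa using finFunctionFinEquiv.symm.injective this

theorem exists_residue_digitInt (hε : IsResidueBasis p ε) (z : 𝓀[K]) :
    ∃ n < residueCard K, IsLocalRing.residue 𝒪[K] (digitInt p ε n) = z := by
  obtain ⟨a, rfl⟩ := hε.2 z
  obtain ⟨n, hn, h⟩ := digitInt_of_digits a (ε := ε)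
  exact ⟨n, residueCard_eq_pow hε ▸ hn, by simp [h]⟩

/-- Characteristic p enters here: base-p digits add modulo p without carry, so the sum is again a
single digit. -/
theorem exists_uDigit_add [Fact p.Prime] [CharP K p] (hε : IsResidueBasis p ε) (m n : ℕ) :
    ∃ d < residueCard K, uDigit p ϖ ε d = uDigit p ϖ ε m + uDigit p ϖ ε n := by
  have hp : 0 < p := (Fact.out : p.Prime).pos
  obtain ⟨d, hd, h⟩ := digitInt_of_digits (ε := ε) fun i : Fin c =>
    ⟨(m / p ^ (i : ℕ) % p + n / p ^ (i : ℕ) % p) % p, Nat.mod_lt _ hp⟩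
  refine ⟨d, residueCard_eq_pow hε ▸ hd, ?_⟩
  rw [uDigit_eq, h, uDigit, uDigit, ← add_mul, ← Finset.sum_add_distrib]
  congr 1
  push_cast
  refine Finset.sum_congr rfl fun i _ => ?_
  rw [← add_mul]
  congr 1
  have := CharP.cast_eq_mod K p (m / p ^ (i : ℕ) % p + n / p ^ (i : ℕ) % p)
  push_cast at this ⊢
  exact this.symm

theorem uDigit_zero : uDigit p ϖ ε 0 = 0 := by simp [uDigit]

theorem u_eq_sum_range {n R : ℕ} (h : n < residueCard K ^ R) :
    u p ϖ ε n = ∑ r ∈ Finset.range R,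
      uDigit p ϖ ε (n / residueCard K ^ r % residueCard K) * (ϖ : K)⁻¹ ^ r := by
  have hq := one_lt_residueCard K
  have key : ∀ R S, R ≤ S → n < residueCard K ^ R →
      ∑ r ∈ Finset.range R,
        uDigit p ϖ ε (n / residueCard K ^ r % residueCard K) * (ϖ : K)⁻¹ ^ r =
      ∑ r ∈ Finset.range S,
        uDigit p ϖ ε (n / residueCard K ^ r % residueCard K) * (ϖ : K)⁻¹ ^ r := by
    intro R S hRS hn
    refine Finset.sum_subset (Finset.range_mono hRS) fun r _ hr => ?_
    have : n < residueCard K ^ r :=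
      hn.trans_le (Nat.pow_le_pow_right hq.le (by simpa using hr))
    simp [Nat.div_eq_of_lt this, uDigit_zero]
  have h' : n < residueCard K ^ (n + 1) :=
    (Nat.lt_pow_self hq).trans (Nat.pow_lt_pow_right hq n.lt_succ_self)
  rw [u, key _ _ (le_max_left (n + 1) R) h', ← key _ _ (le_max_right (n + 1) R) h]

theorem u_zero : u p ϖ ε 0 = 0 := by
  rw [u_eq_sum_range (R := 0) (by simp)]; simp

theorem u_rec (n : ℕ) : u p ϖ ε n =
    uDigit p ϖ ε (n % residueCard K) + u p ϖ ε (n / residueCard K) * (ϖ : K)⁻¹ := by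
  have hq := one_lt_residueCard K
  have h : n < residueCard K ^ (n + 1) :=
    (Nat.lt_pow_self hq).trans (Nat.pow_lt_pow_right hq n.lt_succ_self)
  have h' : n / residueCard K < residueCard K ^ n := by
    rw [Nat.div_lt_iff_lt_mul (by omega), ← pow_succ]; exact h
  rw [u_eq_sum_range h, u_eq_sum_range h', Finset.sum_range_succ', Finset.sum_mul, add_comm]
  congr 1
  · simp
  · refine Finset.sum_congr rfl fun r _ => ?_
    rw [Nat.div_div_eq_div_mul, ← pow_succ', pow_succ (ϖ : K)⁻¹, mul_assoc]

theorem u_of_lt {n : ℕ} (h : n < residueCard K) : u p ϖ ε n = uDigit p ϖ ε n := by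
  rw [u_rec, Nat.mod_eq_of_lt h, Nat.div_eq_of_lt h, u_zero]; simp

/-- Concatenating base-q digit strings: shifting an index by m digits divides by ϖ^m. This is the
source of the inclusion ϖ^(-m)Λ ⊆ Λ and of its coset representatives. -/
theorem u_add_mul {m a : ℕ} (ha : a < residueCard K ^ m) (b : ℕ) :
    u p ϖ ε (a + residueCard K ^ m * b) = u p ϖ ε a + u p ϖ ε b * (ϖ : K)⁻¹ ^ m := by
  have hq := one_lt_residueCard K
  induction m generalizing a with
  | zero =>
    obtain rfl : a = 0 := by simpa using ha
    simp [u_zero]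
  | succ m ih =>
    have h' : a / residueCard K < residueCard K ^ m := by
      rw [Nat.div_lt_iff_lt_mul (by omega), ← pow_succ]; exact ha
    rw [u_rec, u_rec a]
    have e : a + residueCard K ^ (m + 1) * b = a + residueCard K * (residueCard K ^ m * b) := by
      ring
    rw [e, Nat.add_mul_mod_self_left, Nat.add_mul_div_left _ _ (by omega), ih h']
    ring

theorem exists_u_add [Fact p.Prime] [CharP K p] (hε : IsResidueBasis p ε) (m n : ℕ) :
    ∃ k, u p ϖ ε k = u p ϖ ε m + u p ϖ ε n := by
  have hq := one_lt_residueCard K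
  induction m using Nat.strong_induction_on generalizing n with
  | _ m ih =>
    rcases Nat.eq_zero_or_pos m with rfl | hm
    · exact ⟨n, by simp [u_zero]⟩
    obtain ⟨k, hk⟩ := ih (m / residueCard K) (Nat.div_lt_self hm hq) (n / residueCard K)
    obtain ⟨d, hd, hd'⟩ := exists_uDigit_add (ϖ := ϖ) hε (m % residueCard K) (n % residueCard K)
    refine ⟨d + residueCard K ^ 1 * k, ?_⟩
    rw [u_add_mul (by simpa using hd), hk, u_of_lt hd, hd', u_rec m, u_rec n]
    ring

theorem exists_u_neg [Fact p.Prime] [CharP K p] (hε : IsResidueBasis p ε) (n : ℕ) :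
    ∃ k, u p ϖ ε k = - u p ϖ ε n := by
  have key : ∀ j : ℕ, ∃ k, u p ϖ ε k = j * u p ϖ ε n := by
    intro j
    induction j with
    | zero => exact ⟨0, by simp [u_zero]⟩
    | succ j ih =>
      obtain ⟨k, hk⟩ := ih
      obtain ⟨k', hk'⟩ := exists_u_add (ϖ := ϖ) hε k n
      exact ⟨k', by rw [hk', hk]; push_cast; ring⟩
  -- In characteristic p, -x = (p - 1)x, so closure under addition is enough.
  obtain ⟨k, hk⟩ := key (p - 1)
  refine ⟨k, ?_⟩
  rw [hk, Nat.cast_sub (Fact.out : p.Prime).one_le, CharP.cast_eq_zero]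
  simp

section Prime

variable (ϖ) in
theorem valuation_unit_pos : 0 < valuation K (ϖ : K) :=
  zero_lt_iff.mpr ((valuation K).ne_zero_iff.mpr ϖ.ne_zero)

theorem IsPrimeElement.one_lt_inv (hϖ : IsPrimeElement (ϖ : K)) :
    1 < valuation K (ϖ : K)⁻¹ := by
  rw [map_inv₀]; exact (one_lt_inv₀ (valuation_unit_pos ϖ)).mpr hϖ.1

theorem valuation_uDigit_le (n : ℕ) :
    valuation K (uDigit p ϖ ε n) ≤ valuation K (ϖ : K)⁻¹ := by
  rw [uDigit_eq, map_mul]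
  exact mul_le_of_le_one_left' (digitInt p ε n).2

theorem valuation_uDigit_sub (hp : 0 < p) (hε : IsResidueBasis p ε) {m n : ℕ}
    (hm : m < residueCard K) (hn : n < residueCard K) (h : m ≠ n) :
    valuation K (uDigit p ϖ ε m - uDigit p ϖ ε n) = valuation K (ϖ : K)⁻¹ := by
  have h1 := fun h' => h (residue_digitInt_injOn hp hε hm hn h')
  rw [residue_eq_residue_iff] at h1
  have h2 : valuation K ((digitInt p ε m : K) - digitInt p ε n) ≤ 1 :=
    (digitInt p ε m - digitInt p ε n).2
  rw [uDigit_eq, uDigit_eq, ← sub_mul, map_mul, le_antisymm h2 (not_lt.mp h1), one_mul]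

/-- The number i is the highest position at which the base-q digits of m and n differ; the
ultrametric inequality lets that digit dominate. These are the N shells of the remainder estimate.
-/
theorem exists_valuation_u_sub (hp : 0 < p) (hϖ : IsPrimeElement (ϖ : K))
    (hε : IsResidueBasis p ε) {N m n : ℕ} (hm : m < residueCard K ^ N)
    (hn : n < residueCard K ^ N) (h : m ≠ n) :
    ∃ i < N, valuation K (u p ϖ ε m - u p ϖ ε n) = valuation K (ϖ : K)⁻¹ ^ (i + 1) := by
  have hq := one_lt_residueCard K
  induction N generalizing m n with
  | zero =>
    simp at hm hn; omega
  | succ N ih =>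
    have e : u p ϖ ε m - u p ϖ ε n =
        (uDigit p ϖ ε (m % residueCard K) - uDigit p ϖ ε (n % residueCard K)) +
          (u p ϖ ε (m / residueCard K) - u p ϖ ε (n / residueCard K)) * (ϖ : K)⁻¹ := by
      rw [u_rec m, u_rec n]; ring
    by_cases h1 : m / residueCard K = n / residueCard K
    · refine ⟨0, by omega, ?_⟩
      have h2 : m % residueCard K ≠ n % residueCard K := fun h2 => h <| by
        rw [← Nat.div_add_mod m (residueCard K), h1, h2, Nat.div_add_mod]
      rw [e, h1, sub_self, zero_mul, add_zero, zero_add, pow_one]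
      exact valuation_uDigit_sub hp hε (Nat.mod_lt _ (by omega)) (Nat.mod_lt _ (by omega)) h2
    · have hd : ∀ {a}, a < residueCard K ^ (N + 1) → a / residueCard K < residueCard K ^ N := by
        intro a ha
        rw [Nat.div_lt_iff_lt_mul (by omega), ← pow_succ]; exact ha
      obtain ⟨i, hi, hv⟩ := ih (hd hm) (hd hn) h1
      refine ⟨i + 1, by omega, ?_⟩
      have h3 : valuation K ((u p ϖ ε (m / residueCard K) - u p ϖ ε (n / residueCard K)) *
          (ϖ : K)⁻¹) = valuation K (ϖ : K)⁻¹ ^ (i + 1 + 1) := by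
        rw [map_mul, hv, pow_succ _ (i + 1)]
      rw [e, Valuation.map_add_eq_of_lt_right, h3]
      rw [h3]
      refine lt_of_le_of_lt (Valuation.map_sub_le _ (valuation_uDigit_le _) (valuation_uDigit_le _)) ?_
      exact lt_self_pow₀ hϖ.one_lt_inv (by omega)

theorem eq_of_valuation_u_sub_le_one (hp : 0 < p) (hϖ : IsPrimeElement (ϖ : K))
    (hε : IsResidueBasis p ε) {m n : ℕ}
    (h : valuation K (u p ϖ ε m - u p ϖ ε n) ≤ 1) : m = n := by
  by_contra hne
  have hq := one_lt_residueCard K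
  have hlt : ∀ {a b : ℕ}, a ≤ b → a < residueCard K ^ b := fun hab =>
    (Nat.lt_pow_self hq).trans_le (Nat.pow_le_pow_right hq.le hab)
  obtain ⟨i, -, hi⟩ := exists_valuation_u_sub hp hϖ hε (hlt (le_max_left m n))
    (hlt (le_max_right m n)) hne
  rw [hi] at h
  exact absurd h (not_le.mpr (one_lt_pow₀ hϖ.one_lt_inv (by omega)))

theorem exists_uDigit_near (hϖ : IsPrimeElement (ϖ : K))
    (hε : IsResidueBasis p ε) {x : K} (hx : valuation K ((ϖ : K) * x) ≤ 1) :
    ∃ d < residueCard K, valuation K (x - uDigit p ϖ ε d) ≤ 1 := by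
  obtain ⟨d, hd, h⟩ := exists_residue_digitInt hε
    (IsLocalRing.residue 𝒪[K] ⟨(ϖ : K) * x, hx⟩)
  refine ⟨d, hd, ?_⟩
  rw [eq_comm, residue_eq_residue_iff] at h
  have h := hϖ.2 _ h
  have e : x - uDigit p ϖ ε d = ((ϖ : K) * x - digitInt p ε d) * (ϖ : K)⁻¹ := by
    rw [uDigit_eq]
    field_simp
  rw [e, map_mul, map_inv₀, ← div_eq_mul_inv]
  exact div_le_one_of_le₀ h zero_le

theorem exists_u_near_of_pow (hϖ : IsPrimeElement (ϖ : K))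
    (hε : IsResidueBasis p ε) (N : ℕ) {x : K} (hx : valuation K ((ϖ : K) ^ N * x) ≤ 1) :
    ∃ k < residueCard K ^ N, valuation K (x - u p ϖ ε k) ≤ 1 := by
  induction N generalizing x with
  | zero => exact ⟨0, by simp, by simpa [u_zero] using hx⟩
  | succ N ih =>
    -- The higher digits are those of ϖx; the lowest digit is then chosen to correct the remainder.
    obtain ⟨k, hk, h⟩ := ih (x := (ϖ : K) * x) (by rwa [← mul_assoc, ← pow_succ])
    obtain ⟨d, hd, h'⟩ := exists_uDigit_near hϖ hε (x := x - u p ϖ ε k * (ϖ : K)⁻¹) (by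
      convert h using 2
      field_simp)
    refine ⟨d + residueCard K ^ 1 * k, ?_, ?_⟩
    · rw [pow_one, pow_succ']
      calc d + residueCard K * k < residueCard K + residueCard K * k := by omega
        _ = residueCard K * (k + 1) := by ring
        _ ≤ _ := Nat.mul_le_mul_left _ hk
    · rw [u_add_mul (by simpa using hd), u_of_lt hd]
      convert h' using 2
      ring

theorem exists_pow_lt_valuation (hϖ : IsPrimeElement (ϖ : K)) {γ : ValueGroupWithZero K}
    (hγ : γ ≠ 0) : ∃ N : ℕ, valuation K (ϖ : K) ^ N < γ := by
  have : MulArchimedean (ValueGroupWithZero K) :=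
    ValuativeRel.isRankLeOne_iff_mulArchimedean.mp inferInstance
  exact exists_pow_lt₀ hϖ.1 (Units.mk0 γ hγ)

theorem exists_pow_mul_le_one (hϖ : IsPrimeElement (ϖ : K)) (x : K) :
    ∃ N : ℕ, valuation K ((ϖ : K) ^ N * x) ≤ 1 := by
  rcases eq_or_ne x 0 with rfl | hx
  · exact ⟨0, by simp⟩
  have hv : valuation K x ≠ 0 := (valuation K).ne_zero_iff.mpr hx
  obtain ⟨N, hN⟩ := exists_pow_lt_valuation hϖ (inv_ne_zero hv)
  refine ⟨N, ?_⟩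
  rw [map_mul, map_pow]
  calc _ ≤ (valuation K x)⁻¹ * valuation K x := mul_le_mul_left hN.le _
    _ = 1 := inv_mul_cancel₀ hv

theorem exists_u_near (hϖ : IsPrimeElement (ϖ : K)) (hε : IsResidueBasis p ε)
    (x : K) : ∃ k, valuation K (x - u p ϖ ε k) ≤ 1 := by
  obtain ⟨N, hN⟩ := exists_pow_mul_le_one hϖ x
  obtain ⟨k, -, hk⟩ := exists_u_near_of_pow hϖ hε N hN
  exact ⟨k, hk⟩

theorem u_injective (hp : 0 < p) (hϖ : IsPrimeElement (ϖ : K)) (hε : IsResidueBasis p ε) :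
    Function.Injective (u p ϖ ε) := fun m n h =>
  eq_of_valuation_u_sub_le_one hp hϖ hε (by simp [h])

/-- Translation by an element of the group `{u(n)}` permutes the indices. -/
theorem exists_perm_u_add [Fact p.Prime] [CharP K p] (hϖ : IsPrimeElement (ϖ : K))
    (hε : IsResidueBasis p ε) (a : ℕ) :
    ∃ σ : Equiv.Perm ℕ, ∀ b, u p ϖ ε (σ b) = u p ϖ ε b + u p ϖ ε a := by
  have hinj := u_injective (Fact.out : p.Prime).pos hϖ hε
  choose s hs using fun b => exists_u_add (ϖ := ϖ) hε b a
  obtain ⟨a', ha'⟩ := exists_u_neg (ϖ := ϖ) hε a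
  choose t ht using fun b => exists_u_add (ϖ := ϖ) hε b a'
  exact ⟨⟨s, t, fun b => hinj (by rw [ht, hs, ha']; ring),
    fun b => hinj (by rw [hs, ht, ha']; ring)⟩, hs⟩

end Prime

end Arithmetic

/-! ### Scaling of Haar measure under multiplication by powers of the prime element. -/

section Haar

open scoped ENNReal

variable {K : Type*} [Field K] [ValuativeRel K] [TopologicalSpace K] [IsNonarchimedeanLocalField K]
  {p : ℕ} {c : ℕ} {ϖ : Kˣ} {ε : Fin c → 𝒪[K]} [MeasurableSpace K] [BorelSpace K]

theorem isClosed_integers : IsClosed {x : K | valuation K x ≤ 1} := by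
  let := IsTopologicalAddGroup.rightUniformSpace K
  have := isUniformAddGroup_of_addCommGroup (G := K)
  exact (IsNonarchimedeanLocalField.isCompact_closedBall K 1).isClosed

theorem measurableSet_affine_integers (a b : K) :
    MeasurableSet {x : K | valuation K (a * x + b) ≤ 1} :=
  (isClosed_integers.preimage (f := fun x : K => a * x + b) (by fun_prop)).measurableSet

theorem measurableEmbedding_mul (a : Kˣ) : MeasurableEmbedding fun x : K => (a : K) * x :=
  (Homeomorph.mulLeft₀ (a : K) a.ne_zero).measurableEmbedding

theorem measurableEmbedding_sub (y : K) : MeasurableEmbedding fun x : K => x - y :=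
  (Homeomorph.subRight y).measurableEmbedding

theorem haar_integers : haar K {x : K | valuation K x ≤ 1} = 1 :=
  Measure.addHaarMeasure_self (K₀ := integersPositiveCompacts K)

theorem haar_integers_sub (y : K) : haar K {x : K | valuation K (x - y) ≤ 1} = 1 := by
  rw [← haar_integers (K := K),
    ← (measurePreserving_sub_right (haar K) y).measure_preimage
      isClosed_integers.measurableSet.nullMeasurableSet]
  rfl

/-- The set is ϖ⁻¹𝔇, the disjoint union of the q cosets u(d) + 𝔇 with d < q. -/
theorem haar_prime_mul (hp : 0 < p) (hϖ : IsPrimeElement (ϖ : K)) (hε : IsResidueBasis p ε) :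
    haar K {x : K | valuation K ((ϖ : K) * x) ≤ 1} = residueCard K := by
  have e : {x : K | valuation K ((ϖ : K) * x) ≤ 1} =
      ⋃ d ∈ Finset.range (residueCard K), {x : K | valuation K (x - u p ϖ ε d) ≤ 1} := by
    ext x
    simp only [Set.mem_ofPred_eq, Set.mem_iUnion, Finset.mem_range, exists_prop]
    constructor
    · intro hx
      obtain ⟨d, hd, h⟩ := exists_uDigit_near hϖ hε hx
      exact ⟨d, hd, by rwa [u_of_lt hd]⟩
    · rintro ⟨d, hd, h⟩
      rw [u_of_lt hd] at h
      have h2 : valuation K ((x - uDigit p ϖ ε d) + uDigit p ϖ ε d) ≤ valuation K (ϖ : K)⁻¹ :=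
        Valuation.map_add_le _ (h.trans hϖ.one_lt_inv.le) (valuation_uDigit_le d)
      rw [sub_add_cancel] at h2
      rw [map_mul]
      calc _ ≤ valuation K (ϖ : K) * valuation K (ϖ : K)⁻¹ := mul_le_mul_right h2 _
        _ = 1 := by rw [← map_mul, mul_inv_cancel₀ ϖ.ne_zero, map_one]
  rw [e, measure_biUnion_finset]
  · simp [haar_integers_sub]
  · intro d _ d' _ hne
    refine Set.disjoint_left.mpr fun x hx hx' => hne ?_
    refine eq_of_valuation_u_sub_le_one hp hϖ hε ?_
    have := Valuation.map_sub_le (valuation K)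
      (show valuation K (x - u p ϖ ε d') ≤ 1 from hx') (show valuation K (x - u p ϖ ε d) ≤ 1 from hx)
    rwa [sub_sub_sub_cancel_left] at this
  · intro d _
    simpa [sub_eq_add_neg] using measurableSet_affine_integers (1 : K) (-u p ϖ ε d)

theorem map_mul_haar_prime (hp : 0 < p) (hϖ : IsPrimeElement (ϖ : K))
    (hε : IsResidueBasis p ε) :
    (haar K).map (fun x => (ϖ : K) * x) = (residueCard K : ℝ≥0∞) • haar K := by
  let e : K ≃ₜ K := Homeomorph.mulLeft₀ (ϖ : K) ϖ.ne_zero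
  have hmap : ((haar K).map e).IsAddHaarMeasure :=
    AddEquiv.isAddHaarMeasure_map (haar K)
      ({ e.toEquiv with map_add' := fun x y => mul_add (ϖ : K) x y } : K ≃+ K)
      e.continuous e.symm.continuous
  have hreg : ((haar K).map e).Regular := Measure.Regular.map e
  have heq := Measure.isAddLeftInvariant_eq_smul_of_regular ((haar K).map e) (haar K)
  have h1 := congrArg (fun μ : Measure K => μ {x : K | valuation K x ≤ 1}) heq
  simp only [Measure.smul_apply, haar_integers] at h1
  rw [Measure.map_apply e.continuous.measurable isClosed_integers.measurableSet] at h1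
  have h2 : haar K (e ⁻¹' {x : K | valuation K x ≤ 1}) = residueCard K :=
    haar_prime_mul hp hϖ hε
  rw [h2] at h1
  change (haar K).map e = _
  rw [heq]
  ext s hs
  simp only [Measure.smul_apply, smul_eq_mul] at h1 ⊢
  rw [h1, ENNReal.smul_def, ENNReal.smul_def, smul_eq_mul, smul_eq_mul, mul_one]

variable (K) in
theorem residueCard_ne_zero : (residueCard K : ℝ≥0∞) ≠ 0 := by
  simpa using (one_lt_residueCard K).ne_bot

theorem map_mul_haar (hp : 0 < p) (hϖ : IsPrimeElement (ϖ : K))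
    (hε : IsResidueBasis p ε) (j : ℤ) :
    (haar K).map (fun x => ((ϖ ^ j : Kˣ) : K) * x) = (residueCard K : ℝ≥0∞) ^ j • haar K := by
  have hm : ∀ a : Kˣ, Measurable fun x : K => (a : K) * x := fun a =>
    (measurableEmbedding_mul a).measurable
  have hq := residueCard_ne_zero K
  have hq' : (residueCard K : ℝ≥0∞) ≠ ⊤ := ENNReal.natCast_ne_top _
  have step : ∀ i j : ℤ, (haar K).map (fun x => ((ϖ ^ i : Kˣ) : K) * x) =
      (residueCard K : ℝ≥0∞) ^ i • haar K →
      (haar K).map (fun x => ((ϖ ^ j : Kˣ) : K) * x) = (residueCard K : ℝ≥0∞) ^ j • haar K →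
      (haar K).map (fun x => ((ϖ ^ (i + j) : Kˣ) : K) * x) =
        (residueCard K : ℝ≥0∞) ^ (i + j) • haar K := by
    intro i j hi hj
    have : (fun x => ((ϖ ^ (i + j) : Kˣ) : K) * x) =
        (fun x => ((ϖ ^ i : Kˣ) : K) * x) ∘ fun x => ((ϖ ^ j : Kˣ) : K) * x := by
      funext x; simp [zpow_add, mul_assoc]
    rw [this, ← Measure.map_map (hm _) (hm _), hj, Measure.map_smul, hi, smul_smul,
      ENNReal.zpow_add hq hq', mul_comm]
  have h1 : (haar K).map (fun x => ((ϖ ^ (1 : ℤ) : Kˣ) : K) * x) =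
      (residueCard K : ℝ≥0∞) ^ (1 : ℤ) • haar K := by
    simpa using map_mul_haar_prime hp hϖ hε
  have h1' : (haar K).map (fun x => ((ϖ ^ (-1 : ℤ) : Kˣ) : K) * x) =
      (residueCard K : ℝ≥0∞) ^ (-1 : ℤ) • haar K := by
    have := congrArg (Measure.map fun x => ((ϖ ^ (-1 : ℤ) : Kˣ) : K) * x) h1
    rw [Measure.map_map (hm _) (hm _), Measure.map_smul] at this
    have e : (fun x => ((ϖ ^ (-1 : ℤ) : Kˣ) : K) * x) ∘ (fun x => ((ϖ ^ (1 : ℤ) : Kˣ) : K) * x) =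
        id := by
      funext x; simp
    rw [e, Measure.map_id] at this
    conv_rhs => rw [this]
    rw [smul_smul, ← ENNReal.zpow_add hq hq']
    simp
  induction j using Int.induction_on with
  | zero => simp
  | succ n ih => exact step _ _ ih h1
  | pred n ih => exact step _ _ ih h1'

theorem quasiMeasurePreserving_mul (hp : 0 < p) (hϖ : IsPrimeElement (ϖ : K))
    (hε : IsResidueBasis p ε) (j : ℤ) :
    Measure.QuasiMeasurePreserving (fun x => ((ϖ ^ j : Kˣ) : K) * x) (haar K) (haar K) where
  measurable := (measurableEmbedding_mul _).measurable
  absolutelyContinuous := by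
    rw [map_mul_haar hp hϖ hε]
    exact Measure.smul_absolutelyContinuous

/-- The origin lies in every ϖ^n 𝔇, of measure q^(-n). Needed because the shrinking regions of the
second implication close in on a point. -/
theorem haar_singleton (hp : 0 < p) (hϖ : IsPrimeElement (ϖ : K)) (hε : IsResidueBasis p ε)
    (x : K) : haar K {x} = 0 := by
  have h0 : haar K {x} = haar K {(0 : K)} := by simp
  rw [h0]
  have hle : ∀ n : ℕ, haar K {(0 : K)} ≤ ((residueCard K : ℝ≥0∞)⁻¹) ^ n := by
    intro n
    have h := congrArg (fun μ : Measure K => μ {x : K | valuation K x ≤ 1})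
      (map_mul_haar hp hϖ hε (-n : ℤ))
    simp only [Measure.smul_apply, haar_integers, smul_eq_mul, mul_one] at h
    rw [Measure.map_apply (measurableEmbedding_mul _).measurable
      isClosed_integers.measurableSet] at h
    rw [← ENNReal.inv_pow, ← zpow_natCast, ← ENNReal.zpow_neg, ← h]
    refine measure_mono ?_
    rintro _ rfl
    simp
  refine le_antisymm (ge_of_tendsto' (ENNReal.tendsto_pow_atTop_nhds_zero_of_lt_one ?_) hle) zero_le
  rw [ENNReal.inv_lt_one]
  exact_mod_cast one_lt_residueCard K

end Haar

/-! ### Translations and dilations as unitary operators, and their commutation rule. -/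

section Operators

open scoped ENNReal

variable {K : Type*} [Field K] [ValuativeRel K] [TopologicalSpace K] [IsNonarchimedeanLocalField K]
  {p : ℕ} {c : ℕ} {ϖ : Kˣ} {ε : Fin c → 𝒪[K]} [MeasurableSpace K] [BorelSpace K]

theorem translationOp_ae (y : K) (f : L2 K) :
    translationOp y f =ᵐ[haar K] fun x => f (x - y) :=
  Lp.coeFn_compMeasurePreserving f (measurePreserving_sub_right (haar K) y)

theorem dilationOp_ae (j : ℤ) (f : L2 K) :
    dilationOp ϖ j f =ᵐ[haar K] fun x =>
      (((residueCard K : ℝ) ^ ((j : ℝ) / 2) : ℝ) : ℂ) * f (((ϖ ^ (-j) : Kˣ) : K) * x) := by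
  refine (Lp.coeFn_smul _ _).trans ?_
  filter_upwards [(memLp_comp_mul (ϖ ^ (-j)) (Lp.memLp f)).coeFn_toLp] with x hx
  rw [Pi.smul_apply, hx, smul_eq_mul]

theorem translationOp_zero (f : L2 K) : translationOp 0 f = f := by
  refine Lp.ext ((translationOp_ae 0 f).trans ?_)
  simp

theorem translationOp_translationOp (y z : K) (f : L2 K) :
    translationOp y (translationOp z f) = translationOp (y + z) f := by
  refine Lp.ext ?_
  have h := (measurePreserving_sub_right (haar K) y).quasiMeasurePreserving.ae_eq_comp
    (translationOp_ae z f)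
  filter_upwards [translationOp_ae y (translationOp z f), translationOp_ae (y + z) f, h]
    with x h1 h2 h3
  rw [h1, h2]
  simpa [sub_sub] using h3

theorem inner_translationOp (y : K) (f g : L2 K) :
    inner ℂ (translationOp y f) (translationOp y g) = inner ℂ f g := by
  rw [L2.inner_def, L2.inner_def]
  rw [← (measurePreserving_sub_right (haar K) y).integral_comp (measurableEmbedding_sub y)
    fun x => inner ℂ (f x) (g x)]
  refine integral_congr_ae ?_
  filter_upwards [translationOp_ae y f, translationOp_ae y g] with x h1 h2
  rw [h1, h2]

theorem inner_translationOp_left (y : K) (f g : L2 K) :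
    inner ℂ (translationOp y f) g = inner ℂ f (translationOp (-y) g) := by
  rw [← inner_translationOp (-y), translationOp_translationOp, neg_add_cancel, translationOp_zero]

theorem norm_translationOp (y : K) (f : L2 K) : ‖translationOp y f‖ = ‖f‖ :=
  Lp.norm_compMeasurePreserving f (measurePreserving_sub_right (haar K) y)

theorem rpow_half_mul_self (j : ℤ) :
    (residueCard K : ℝ) ^ ((j : ℝ) / 2) * (residueCard K : ℝ) ^ ((j : ℝ) / 2) =
      (residueCard K : ℝ) ^ j := by
  have hq : 0 < (residueCard K : ℝ) := by exact_mod_cast (one_lt_residueCard K).le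
  rw [← Real.rpow_add hq, add_halves, Real.rpow_intCast]

theorem enorm_rpow_half_sq (j : ℤ) :
    ‖(((residueCard K : ℝ) ^ ((j : ℝ) / 2) : ℝ) : ℂ)‖ₑ ^ 2 = (residueCard K : ℝ≥0∞) ^ j := by
  have hq : 0 < (residueCard K : ℝ) := by exact_mod_cast (one_lt_residueCard K).le
  have h0 : 0 ≤ (residueCard K : ℝ) ^ ((j : ℝ) / 2) := Real.rpow_nonneg hq.le _
  rw [← ofReal_norm, Complex.norm_real, Real.norm_of_nonneg h0, sq,
    ← ENNReal.ofReal_mul h0, rpow_half_mul_self, ← Real.rpow_intCast,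
    ← ENNReal.ofReal_rpow_of_pos hq, ENNReal.ofReal_natCast, ENNReal.rpow_intCast]

theorem dilationOp_dilationOp (hp : 0 < p) (hϖ : IsPrimeElement (ϖ : K))
    (hε : IsResidueBasis p ε) (i j : ℤ) (f : L2 K) :
    dilationOp ϖ i (dilationOp ϖ j f) = dilationOp ϖ (i + j) f := by
  have hq : 0 < (residueCard K : ℝ) := by exact_mod_cast (one_lt_residueCard K).le
  refine Lp.ext ?_
  have h := (quasiMeasurePreserving_mul hp hϖ hε (-i)).ae_eq_comp (dilationOp_ae (ϖ := ϖ) j f)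
  filter_upwards [dilationOp_ae (ϖ := ϖ) i (dilationOp ϖ j f), dilationOp_ae (ϖ := ϖ) (i + j) f, h]
    with x h1 h2 h3
  rw [h1, h2]
  simp only [Function.comp_apply] at h3
  rw [h3, ← mul_assoc, ← Complex.ofReal_mul, ← Real.rpow_add hq, ← mul_assoc, ← Units.val_mul,
    ← zpow_add]
  congr 3
  · push_cast; ring_nf
  · congr 2; ring_nf

theorem dilationOp_translationOp (hp : 0 < p) (hϖ : IsPrimeElement (ϖ : K))
    (hε : IsResidueBasis p ε) (j : ℤ) (y : K) (f : L2 K) :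
    dilationOp ϖ j (translationOp y f) =
      translationOp (((ϖ ^ j : Kˣ) : K) * y) (dilationOp ϖ j f) := by
  refine Lp.ext ?_
  have h := (quasiMeasurePreserving_mul hp hϖ hε (-j)).ae_eq_comp (translationOp_ae y f)
  have h' := (measurePreserving_sub_right (haar K)
    (((ϖ ^ j : Kˣ) : K) * y)).quasiMeasurePreserving.ae_eq_comp (dilationOp_ae (ϖ := ϖ) j f)
  filter_upwards [dilationOp_ae (ϖ := ϖ) j (translationOp y f),
    translationOp_ae (((ϖ ^ j : Kˣ) : K) * y) (dilationOp ϖ j f), h, h'] with x h1 h2 h3 h4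
  simp only [Function.comp_apply] at h3 h4
  rw [h1, h2, h3, h4, mul_sub, ← mul_assoc _ _ y, ← Units.val_mul, ← zpow_add]
  simp

theorem inner_dilationOp (hp : 0 < p) (hϖ : IsPrimeElement (ϖ : K))
    (hε : IsResidueBasis p ε) (j : ℤ) (f g : L2 K) :
    inner ℂ (dilationOp ϖ j f) (dilationOp ϖ j g) = inner ℂ f g := by
  have hq : 0 < (residueCard K : ℝ) := by exact_mod_cast (one_lt_residueCard K).le
  rw [L2.inner_def, L2.inner_def]
  have h : ∫ x, inner ℂ (f (((ϖ ^ (-j) : Kˣ) : K) * x)) (g (((ϖ ^ (-j) : Kˣ) : K) * x)) ∂haar K =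
      ((residueCard K : ℝ) ^ (-j)) • ∫ x, inner ℂ (f x) (g x) ∂haar K := by
    rw [← (measurableEmbedding_mul (ϖ ^ (-j))).integral_map (fun x => inner ℂ (f x) (g x)),
      map_mul_haar hp hϖ hε, integral_smul_measure]
    congr 1
    rw [← ENNReal.rpow_intCast, ← ENNReal.toReal_rpow, ENNReal.toReal_natCast, Real.rpow_intCast]
  have h2 : ∫ x, inner ℂ (dilationOp ϖ j f x) (dilationOp ϖ j g x) ∂haar K =
      ∫ x, (((residueCard K : ℝ) ^ j : ℝ) : ℂ) *
        inner ℂ (f (((ϖ ^ (-j) : Kˣ) : K) * x)) (g (((ϖ ^ (-j) : Kˣ) : K) * x)) ∂haar K := by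
    refine integral_congr_ae ?_
    filter_upwards [dilationOp_ae (ϖ := ϖ) j f, dilationOp_ae (ϖ := ϖ) j g] with x h1 h2
    simp only [RCLike.inner_apply]
    rw [h1, h2, ← rpow_half_mul_self, map_mul, Complex.conj_ofReal, Complex.ofReal_mul]
    ring
  rw [h2, integral_const_mul, h, Complex.real_smul, ← mul_assoc, ← Complex.ofReal_mul,
    ← zpow_add₀ hq.ne']
  simp

theorem norm_dilationOp (hp : 0 < p) (hϖ : IsPrimeElement (ϖ : K))
    (hε : IsResidueBasis p ε) (j : ℤ) (f : L2 K) : ‖dilationOp ϖ j f‖ = ‖f‖ := by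
  rw [@norm_eq_sqrt_re_inner ℂ, inner_dilationOp hp hϖ hε, ← @norm_eq_sqrt_re_inner ℂ]

end Operators

/-! ### The measures |h|² dx and a localized Cauchy–Schwarz inequality. -/

section Mass

open scoped ENNReal

variable {K : Type*} [Field K] [ValuativeRel K] [TopologicalSpace K] [IsNonarchimedeanLocalField K]
  {p : ℕ} {c : ℕ} {ϖ : Kˣ} {ε : Fin c → 𝒪[K]} [MeasurableSpace K] [BorelSpace K]

/-- The measure `|h|² dx`. -/
noncomputable def mass (h : L2 K) : Measure K := (haar K).withDensity fun x => ‖h x‖ₑ ^ 2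

theorem mass_apply (h : L2 K) {S : Set K} (hS : MeasurableSet S) :
    mass h S = ∫⁻ x in S, ‖h x‖ₑ ^ 2 ∂haar K := withDensity_apply _ hS

theorem lintegral_enorm_sq (h : L2 K) : ∫⁻ x, ‖h x‖ₑ ^ 2 ∂haar K = ‖h‖ₑ ^ 2 := by
  rw [Lp.enorm_def, eLpNorm_eq_lintegral_rpow_enorm_toReal (by norm_num) (by norm_num),
    ← ENNReal.rpow_natCast, ← ENNReal.rpow_mul]
  norm_num

theorem mass_univ (h : L2 K) : mass h Set.univ = ‖h‖ₑ ^ 2 := by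
  rw [mass_apply h MeasurableSet.univ, Measure.restrict_univ, lintegral_enorm_sq]

instance (h : L2 K) : IsFiniteMeasure (mass h) :=
  ⟨by rw [mass_univ]; exact ENNReal.pow_lt_top enorm_lt_top⟩

theorem mass_absolutelyContinuous (h : L2 K) : mass h ≪ haar K :=
  withDensity_absolutelyContinuous _ _

theorem mass_translationOp (y : K) (h : L2 K) {S : Set K} (hS : MeasurableSet S) :
    mass (translationOp y h) S = mass h {x | x + y ∈ S} := by
  have hS' : MeasurableSet {x | x + y ∈ S} := (measurable_add_const y) hS
  rw [mass_apply _ hS, mass_apply _ hS',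
    ← (measurePreserving_sub_right (haar K) y).setLIntegral_comp_preimage_emb
      (measurableEmbedding_sub y) (fun x => ‖h x‖ₑ ^ 2)]
  have e : (fun x => x - y) ⁻¹' {x | x + y ∈ S} = S := by ext; simp
  rw [e]
  refine lintegral_congr_ae (ae_restrict_of_ae ?_)
  filter_upwards [translationOp_ae y h] with x hx
  rw [hx]

/-- The normalization q^(j/2), squared, cancels the Jacobian, so no factor remains. -/
theorem mass_dilationOp (hp : 0 < p) (hϖ : IsPrimeElement (ϖ : K))
    (hε : IsResidueBasis p ε) (j : ℤ) (h : L2 K) {S : Set K} (hS : MeasurableSet S) :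
    mass (dilationOp ϖ j h) S = mass h {x | ((ϖ ^ j : Kˣ) : K) * x ∈ S} := by
  have hS' : MeasurableSet {x | ((ϖ ^ j : Kˣ) : K) * x ∈ S} :=
    (measurableEmbedding_mul (ϖ ^ j)).measurable hS
  have e : (fun x => ((ϖ ^ (-j) : Kˣ) : K) * x) ⁻¹' {x | ((ϖ ^ j : Kˣ) : K) * x ∈ S} = S := by
    ext x
    simp only [Set.mem_preimage, Set.mem_ofPred_eq, ← mul_assoc, ← Units.val_mul, ← zpow_add]
    simp
  have h1 : ∫⁻ x in S, ‖h (((ϖ ^ (-j) : Kˣ) : K) * x)‖ₑ ^ 2 ∂haar K =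
      (residueCard K : ℝ≥0∞) ^ (-j) * mass h {x | ((ϖ ^ j : Kˣ) : K) * x ∈ S} := by
    rw [mass_apply _ hS', ← smul_eq_mul, ← lintegral_smul_measure, ← Measure.restrict_smul,
      ← map_mul_haar hp hϖ hε (-j), (measurableEmbedding_mul (ϖ ^ (-j))).restrict_map,
      (measurableEmbedding_mul (ϖ ^ (-j))).lintegral_map, e]
  have h2 : ∫⁻ x in S, ‖dilationOp ϖ j h x‖ₑ ^ 2 ∂haar K =
      ∫⁻ x in S, (residueCard K : ℝ≥0∞) ^ j * ‖h (((ϖ ^ (-j) : Kˣ) : K) * x)‖ₑ ^ 2 ∂haar K := by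
    refine lintegral_congr_ae (ae_restrict_of_ae ?_)
    filter_upwards [dilationOp_ae (ϖ := ϖ) j h] with x hx
    rw [hx, enorm_mul, mul_pow, enorm_rpow_half_sq]
  have hq := residueCard_ne_zero K
  have hq' : (residueCard K : ℝ≥0∞) ≠ ⊤ := ENNReal.natCast_ne_top _
  rw [mass_apply _ hS, h2, lintegral_const_mul' _ _ (ENNReal.zpow_ne_top hq hq' _), h1, ← mul_assoc,
    ← ENNReal.zpow_add hq hq']
  simp

/-- The functions in `L²` vanishing almost everywhere outside `S`. -/
def VanishesOff (S : Set K) (f : L2 K) : Prop := ∀ᵐ x ∂haar K, x ∉ S → f x = 0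

theorem VanishesOff.translationOp {S : Set K} {f : L2 K} (hf : VanishesOff S f) (y : K) :
    VanishesOff {x | x - y ∈ S} (translationOp y f) := by
  have := (measurePreserving_sub_right (haar K) y).quasiMeasurePreserving.ae hf
  filter_upwards [translationOp_ae y f, this] with x h1 h2 hx
  rw [h1]
  exact h2 hx

theorem VanishesOff.dilationOp (hp : 0 < p) (hϖ : IsPrimeElement (ϖ : K))
    (hε : IsResidueBasis p ε) {S : Set K} {f : L2 K} (hf : VanishesOff S f) (j : ℤ) :
    VanishesOff {x | ((ϖ ^ (-j) : Kˣ) : K) * x ∈ S} (dilationOp ϖ j f) := by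
  have := (quasiMeasurePreserving_mul hp hϖ hε (-j)).ae hf
  filter_upwards [dilationOp_ae (ϖ := ϖ) j f, this] with x h1 h2 hx
  rw [h1, h2 hx, mul_zero]

theorem VanishesOff.mono {S T : Set K} {f : L2 K} (hf : VanishesOff S f) (h : S ⊆ T) :
    VanishesOff T f := by
  filter_upwards [hf] with x hx hxT
  exact hx fun hS => hxT (h hS)

/-- Cauchy–Schwarz, localized to the support of one of the functions. -/
theorem enorm_inner_sq_le_mass {S : Set K} (hS : MeasurableSet S) {f : L2 K}
    (hf : VanishesOff S f) (h : L2 K) :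
    ‖(inner ℂ h f : ℂ)‖ₑ ^ 2 ≤ ‖f‖ₑ ^ 2 * mass h S := by
  have hm : AEMeasurable (fun x => ‖h x‖ₑ) ((haar K).restrict S) :=
    (Lp.aestronglyMeasurable h).enorm.restrict
  have hm' : AEMeasurable (fun x => ‖f x‖ₑ) ((haar K).restrict S) :=
    (Lp.aestronglyMeasurable f).enorm.restrict
  have h1 : ‖(inner ℂ h f : ℂ)‖ₑ ≤ ∫⁻ x in S, ‖h x‖ₑ * ‖f x‖ₑ ∂haar K := by
    rw [L2.inner_def]
    refine (enorm_integral_le_lintegral_enorm _).trans ?_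
    rw [← lintegral_indicator hS]
    refine lintegral_mono_ae ?_
    filter_upwards [hf] with x hx
    by_cases hxS : x ∈ S
    · rw [Set.indicator_of_mem hxS, RCLike.inner_apply, enorm_mul, RCLike.enorm_conj, mul_comm]
    · simp [hx hxS]
  have h2 := ENNReal.lintegral_mul_le_Lp_mul_Lq ((haar K).restrict S)
    (Real.HolderConjugate.two_two) hm hm'
  have h3 : ∫⁻ x in S, ‖f x‖ₑ ^ 2 ∂haar K ≤ ‖f‖ₑ ^ 2 := by
    rw [← lintegral_enorm_sq f]
    exact setLIntegral_le_lintegral _ _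
  have h4 : ∀ a : ℝ≥0∞, (a ^ (1 / 2 : ℝ)) ^ 2 = a := by
    intro a
    rw [← ENNReal.rpow_natCast, ← ENNReal.rpow_mul]
    norm_num
  calc ‖(inner ℂ h f : ℂ)‖ₑ ^ 2 ≤ (∫⁻ x in S, ‖h x‖ₑ * ‖f x‖ₑ ∂haar K) ^ 2 := by gcongr
    _ ≤ ((∫⁻ x in S, ‖h x‖ₑ ^ (2 : ℝ) ∂haar K) ^ (1 / 2 : ℝ) *
        (∫⁻ x in S, ‖f x‖ₑ ^ (2 : ℝ) ∂haar K) ^ (1 / 2 : ℝ)) ^ 2 := by gcongr; exact h2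
    _ = mass h S * ∫⁻ x in S, ‖f x‖ₑ ^ 2 ∂haar K := by
      rw [mul_pow, h4, h4, mass_apply h hS]
      simp
    _ ≤ _ := by rw [mul_comm]; gcongr

end Mass

/-! ### Averaging sums over Λ, for values in a general monoid so as to serve both energies and
bilinear sums. -/

section Lattice

variable {K : Type*} [Field K] [ValuativeRel K] [TopologicalSpace K] [IsNonarchimedeanLocalField K]
  {p : ℕ} [Fact p.Prime] [CharP K p] {c : ℕ} {ϖ : Kˣ} {ε : Fin c → 𝒪[K]}
  {E : Type*} [AddCommMonoid E] [TopologicalSpace E]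

theorem tsum_u_add (hϖ : IsPrimeElement (ϖ : K)) (hε : IsResidueBasis p ε) (H : K → E) (r : K)
    (a : ℕ) : ∑' b, H (r * (u p ϖ ε b + u p ϖ ε a)) = ∑' b, H (r * u p ϖ ε b) := by
  obtain ⟨σ, hσ⟩ := exists_perm_u_add hϖ hε a
  rw [← σ.tsum_eq fun b => H (r * u p ϖ ε b)]
  simp_rw [hσ]

/-- For j ≥ 0 one has Λ ⊆ ϖ^j Λ, namely u(a) = ϖ^j u(q^j a), so translation by u(a) only permutes
the sum. -/
theorem sum_tsum_u_dilate (hϖ : IsPrimeElement (ϖ : K)) (hε : IsResidueBasis p ε) (H : K → E)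
    (j N : ℕ) :
    ∑ a ∈ Finset.range (residueCard K ^ N), ∑' b, H ((ϖ : K) ^ j * u p ϖ ε b + u p ϖ ε a) =
      residueCard K ^ N • ∑' b, H ((ϖ : K) ^ j * u p ϖ ε b) := by
  have h : ∀ a, ∑' b, H ((ϖ : K) ^ j * u p ϖ ε b + u p ϖ ε a) =
      ∑' b, H ((ϖ : K) ^ j * u p ϖ ε b) := by
    intro a
    rw [← tsum_u_add hϖ hε H ((ϖ : K) ^ j) (residueCard K ^ j * a)]
    refine tsum_congr fun b => congrArg H ?_
    have := u_add_mul (p := p) (ϖ := ϖ) (ε := ε) (pow_pos (one_lt_residueCard K).le j) a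
    rw [zero_add, u_zero, zero_add] at this
    rw [this, mul_add, mul_left_comm, ← mul_pow, mul_inv_cancel₀ ϖ.ne_zero, one_pow, mul_one]
  simp [h]

theorem exists_equiv_finProd (n : ℕ) [NeZero n] :
    ∃ e : Fin n × ℕ ≃ ℕ, ∀ x, e x = x.1 + n * x.2 := by
  refine ⟨(Equiv.prodComm _ _).trans (Nat.divModEquiv n).symm, fun x => ?_⟩
  simp [Nat.divModEquiv]
  ring

/-- Decomposes Λ into the q^m cosets of ϖ^(-m)Λ by writing n = a + q^m b. -/
theorem tsum_u_eq_sum_tsum [ContinuousAdd E] [T3Space E] (H : K → E) (m : ℕ)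
    (hs : Summable fun n => H (u p ϖ ε n))
    (hs' : ∀ a, Summable fun b => H ((ϖ : K)⁻¹ ^ m * u p ϖ ε b + u p ϖ ε a)) :
    ∑' n, H (u p ϖ ε n) = ∑ a ∈ Finset.range (residueCard K ^ m),
      ∑' b, H ((ϖ : K)⁻¹ ^ m * u p ϖ ε b + u p ϖ ε a) := by
  have : NeZero (residueCard K ^ m) := ⟨(pow_pos (one_lt_residueCard K).le m).ne'⟩
  obtain ⟨e, he'⟩ := exists_equiv_finProd (residueCard K ^ m)
  have he : ∀ x : Fin (residueCard K ^ m) × ℕ, H (u p ϖ ε (e x)) =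
      H ((ϖ : K)⁻¹ ^ m * u p ϖ ε x.2 + u p ϖ ε x.1) := by
    intro x
    rw [he', u_add_mul x.1.2, mul_comm, add_comm]
  rw [← e.tsum_eq fun n => H (u p ϖ ε n)]
  have hs2 : Summable fun x : Fin (residueCard K ^ m) × ℕ => H (u p ϖ ε (e x)) :=
    (e.summable_iff (f := fun n => H (u p ϖ ε n))).mpr hs
  rw [hs2.tsum_prod' fun a => by simpa only [he] using hs' a]
  simp_rw [he]
  rw [tsum_fintype, Finset.sum_range]

/-- The inner sum depends only on the coset of u(a) modulo ϖ^(-m)Λ, that is, on a modulo q^m. The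
range a < q^N runs through all cosets q^(N-m) times. -/
theorem sum_tsum_u_contract [ContinuousAdd E] [T3Space E] (hϖ : IsPrimeElement (ϖ : K))
    (hε : IsResidueBasis p ε) (H : K → E) {m N : ℕ} (hm : m ≤ N)
    (hs : Summable fun n => H (u p ϖ ε n))
    (hs' : ∀ a, Summable fun b => H ((ϖ : K)⁻¹ ^ m * u p ϖ ε b + u p ϖ ε a)) :
    ∑ a ∈ Finset.range (residueCard K ^ N), ∑' b, H ((ϖ : K)⁻¹ ^ m * u p ϖ ε b + u p ϖ ε a) =
      residueCard K ^ (N - m) • ∑' n, H (u p ϖ ε n) := by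
  set S : ℕ → E := fun a => ∑' b, H ((ϖ : K)⁻¹ ^ m * u p ϖ ε b + u p ϖ ε a) with hS
  have hper : ∀ a < residueCard K ^ m, ∀ n, S (residueCard K ^ m * n + a) = S a := by
    intro a ha n
    simp only [hS]
    rw [← tsum_u_add hϖ hε (fun y => H (y + u p ϖ ε a)) ((ϖ : K)⁻¹ ^ m) n]
    refine tsum_congr fun b => congrArg H ?_
    rw [add_comm (residueCard K ^ m * n), u_add_mul ha]
    ring
  have key : ∀ n, ∑ a ∈ Finset.range (residueCard K ^ m * n), S a =
      n • ∑ a ∈ Finset.range (residueCard K ^ m), S a := by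
    intro n
    induction n with
    | zero => simp
    | succ n ih =>
      rw [mul_add, mul_one, Finset.sum_range_add, ih, succ_nsmul]
      congr 1
      exact Finset.sum_congr rfl fun a ha => hper a (Finset.mem_range.mp ha) n
  rw [tsum_u_eq_sum_tsum H m hs hs', ← key, ← pow_add, Nat.add_sub_cancel' hm]

end Lattice

/-! ### Energies and bilinear sums; the quasi-affine system as an average of affine ones. -/

section Systems

open scoped ENNReal

variable {K : Type*} [Field K] [ValuativeRel K] [TopologicalSpace K] [IsNonarchimedeanLocalField K]
  {p : ℕ} [Fact p.Prime] [CharP K p] {c : ℕ} {ϖ : Kˣ} {ε : Fin c → 𝒪[K]}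
  [MeasurableSpace K] [BorelSpace K] {L : ℕ}

/-- The affine system as a family over all indices. -/
noncomputable def affineSystem (p : ℕ) {c : ℕ} (ϖ : Kˣ) (ε : Fin c → 𝒪[K]) {L : ℕ}
    (Ψ : Fin L → L2 K) (i : Fin L × ℤ × ℕ) : L2 K :=
  affineElt p ϖ ε (Ψ i.1) i.2.1 i.2.2

/-- The quasi-affine system as a family over all indices. -/
noncomputable def quasiAffineSystem (p : ℕ) {c : ℕ} (ϖ : Kˣ) (ε : Fin c → 𝒪[K]) {L : ℕ}
    (Ψ : Fin L → L2 K) (i : Fin L × ℤ × ℕ) : L2 K :=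
  quasiAffineElt p ϖ ε (Ψ i.1) i.2.1 i.2.2

/-- The part `∑ |⟨f, vᵢ⟩|²` over the scales `j ∈ s`. -/
noncomputable def energy (s : Set ℤ) (v : Fin L × ℤ × ℕ → L2 K) (f : L2 K) : ℝ≥0∞ :=
  ∑' i : Fin L × ℤ × ℕ, Set.indicator {i | i.2.1 ∈ s} (fun i => ‖(inner ℂ (v i) f : ℂ)‖ₑ ^ 2) i

/-- The part `∑ ⟨f, vᵢ⟩ ⟨wᵢ, g⟩` over the scales `j ∈ s`. -/
noncomputable def crossSum (s : Set ℤ) (v w : Fin L × ℤ × ℕ → L2 K) (f g : L2 K) : ℂ :=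
  ∑' i : Fin L × ℤ × ℕ,
    Set.indicator {i | i.2.1 ∈ s} (fun i => (inner ℂ (v i) f : ℂ) * inner ℂ g (w i)) i

theorem affineElt_eq (hϖ : IsPrimeElement (ϖ : K)) (hε : IsResidueBasis p ε) (f : L2 K) (j : ℤ)
    (k : ℕ) : affineElt p ϖ ε f j k =
      translationOp (((ϖ ^ j : Kˣ) : K) * u p ϖ ε k) (dilationOp ϖ j f) :=
  dilationOp_translationOp (Fact.out : p.Prime).pos hϖ hε j _ f

theorem inner_translationOp_translationOp (y z : K) (f h : L2 K) :
    inner ℂ (translationOp y h) (translationOp (-z) f) =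
      (inner ℂ (translationOp (y + z) h) f : ℂ) := by
  rw [← inner_translationOp_left, translationOp_translationOp, add_comm]

theorem inner_translationOp_translationOp' (y z : K) (f h : L2 K) :
    inner ℂ (translationOp (-z) f) (translationOp y h) =
      (inner ℂ f (translationOp (y + z) h) : ℂ) := by
  rw [← inner_conj_symm, inner_translationOp_translationOp, inner_conj_symm]

theorem energy_eq_tsum (s : Set ℤ) (v : Fin L × ℤ × ℕ → L2 K) (f : L2 K) :
    energy s v f = ∑' x : Fin L × ℤ, Set.indicator {x | x.2 ∈ s}
      (fun x => ∑' k, ‖(inner ℂ (v (x.1, x.2, k)) f : ℂ)‖ₑ ^ 2) x := by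
  rw [energy, ← (Equiv.prodAssoc (Fin L) ℤ ℕ).tsum_eq, ENNReal.tsum_prod']
  refine tsum_congr fun x => ?_
  by_cases hx : x.2 ∈ s <;> simp [Set.indicator, hx]

theorem energy_mono {s t : Set ℤ} (h : s ⊆ t) (v : Fin L × ℤ × ℕ → L2 K) (f : L2 K) :
    energy s v f ≤ energy t v f :=
  ENNReal.tsum_le_tsum fun i =>
    Set.indicator_le_indicator_of_subset (s := {i : Fin L × ℤ × ℕ | i.2.1 ∈ s})
      (t := {i : Fin L × ℤ × ℕ | i.2.1 ∈ t}) (fun _ hi => h hi) (fun _ => zero_le) i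

/-- The Bessel inequality with bound `B` for a family indexed by `Fin L × ℤ × ℕ`. -/
def BesselBound (B : ℝ≥0∞) (v : Fin L × ℤ × ℕ → L2 K) : Prop :=
  ∀ f, energy Set.univ v f ≤ B * ‖f‖ₑ ^ 2

theorem energy_univ (v : Fin L × ℤ × ℕ → L2 K) (f : L2 K) :
    energy Set.univ v f = ∑' i, ‖(inner ℂ (v i) f : ℂ)‖ₑ ^ 2 := by
  simp [energy]

theorem isAffineBessel_iff (Ψ : Fin L → L2 K) :
    IsAffineBessel p ϖ ε Ψ ↔ ∃ B : ℝ≥0∞, B ≠ ⊤ ∧ BesselBound B (affineSystem p ϖ ε Ψ) := by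
  have hr : ∀ x : ℂ, ‖x‖ₑ ^ 2 = ENNReal.ofReal (‖x‖ ^ 2) := fun x => by
    rw [ENNReal.ofReal_pow (norm_nonneg _), ofReal_norm]
  have hr' : ∀ x : L2 K, ‖x‖ₑ ^ 2 = ENNReal.ofReal (‖x‖ ^ 2) := fun x => by
    rw [ENNReal.ofReal_pow (norm_nonneg _), ofReal_norm]
  constructor
  · rintro ⟨B, hB, h⟩
    refine ⟨ENNReal.ofReal B, ENNReal.ofReal_ne_top, fun f => ?_⟩
    obtain ⟨h1, h2⟩ := h f
    rw [energy_univ, hr', ← ENNReal.ofReal_mul hB.le]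
    simp_rw [hr]
    change ∑' i : Fin L × ℤ × ℕ, ENNReal.ofReal
      (‖pair f (affineElt p ϖ ε (Ψ i.1) i.2.1 i.2.2)‖ ^ 2) ≤ _
    rw [← ENNReal.ofReal_tsum_of_nonneg (fun _ => sq_nonneg _) h1]
    exact ENNReal.ofReal_le_ofReal h2
  · rintro ⟨B, hB, h⟩
    -- The summand 1 makes the bound strictly positive even when B = 0.
    refine ⟨B.toReal + 1, by positivity, fun f => ?_⟩
    have h1 := h f
    rw [energy_univ, hr', ← ENNReal.ofReal_toReal hB,
      ← ENNReal.ofReal_mul ENNReal.toReal_nonneg] at h1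
    simp_rw [hr] at h1
    have hs : Summable fun i : Fin L × ℤ × ℕ =>
        ‖pair f (affineElt p ϖ ε (Ψ i.1) i.2.1 i.2.2)‖ ^ 2 := by
      have := ENNReal.summable_toReal (h1.trans_lt ENNReal.ofReal_lt_top).ne
      refine this.congr fun i => ?_
      rw [ENNReal.toReal_ofReal (sq_nonneg _)]
      rfl
    refine ⟨hs, ?_⟩
    change ∑' i : Fin L × ℤ × ℕ, ENNReal.ofReal
      (‖pair f (affineElt p ϖ ε (Ψ i.1) i.2.1 i.2.2)‖ ^ 2) ≤ _ at h1
    rw [← ENNReal.ofReal_tsum_of_nonneg (fun _ => sq_nonneg _) hs,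
      ENNReal.ofReal_le_ofReal_iff (by positivity)] at h1
    nlinarith [sq_nonneg ‖f‖]

theorem enorm_mul_le_sq_add_sq (a b : ℂ) : ‖a * b‖ₑ ≤ ‖a‖ₑ ^ 2 + ‖b‖ₑ ^ 2 := by
  rw [enorm_mul]
  rcases le_total ‖a‖ₑ ‖b‖ₑ with h | h
  · calc _ ≤ ‖b‖ₑ * ‖b‖ₑ := by gcongr
      _ = ‖b‖ₑ ^ 2 := (sq _).symm
      _ ≤ _ := le_add_self
  · calc _ ≤ ‖a‖ₑ * ‖a‖ₑ := by gcongr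
      _ = ‖a‖ₑ ^ 2 := (sq _).symm
      _ ≤ _ := le_self_add

theorem tsum_enorm_cross_le (s : Set ℤ) (v w : Fin L × ℤ × ℕ → L2 K) (f g : L2 K) :
    ∑' i, ‖Set.indicator {i : Fin L × ℤ × ℕ | i.2.1 ∈ s}
        (fun i => (inner ℂ (v i) f : ℂ) * inner ℂ g (w i)) i‖ₑ ≤
      energy s v f + energy s w g := by
  rw [energy, energy, ← ENNReal.tsum_add]
  refine ENNReal.tsum_le_tsum fun i => ?_
  by_cases hi : i.2.1 ∈ s
  · simp only [Set.indicator, Set.mem_ofPred_eq, hi, if_true]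
    refine (enorm_mul_le_sq_add_sq _ _).trans_eq ?_
    rw [← inner_conj_symm g, RCLike.enorm_conj]
  · simp [Set.indicator, hi]

/-- A crude substitute for Cauchy–Schwarz. It suffices because in the limits below both energies
tend to 0. -/
theorem enorm_crossSum_le (s : Set ℤ) (v w : Fin L × ℤ × ℕ → L2 K) (f g : L2 K) :
    ‖crossSum s v w f g‖ₑ ≤ energy s v f + energy s w g :=
  enorm_tsum_le_tsum_enorm.trans (tsum_enorm_cross_le s v w f g)

theorem BesselBound.energy_lt_top {B : ℝ≥0∞} (hB : B ≠ ⊤) {v : Fin L × ℤ × ℕ → L2 K}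
    (hv : BesselBound B v) (s : Set ℤ) (f : L2 K) : energy s v f < ⊤ :=
  ((energy_mono (Set.subset_univ s) v f).trans (hv f)).trans_lt
    (ENNReal.mul_lt_top hB.lt_top (ENNReal.pow_lt_top enorm_lt_top))

theorem summable_cross {B B' : ℝ≥0∞} (hB : B ≠ ⊤) (hB' : B' ≠ ⊤) {v w : Fin L × ℤ × ℕ → L2 K}
    (hv : BesselBound B v) (hw : BesselBound B' w) (s : Set ℤ) (f g : L2 K) :
    Summable (Set.indicator {i : Fin L × ℤ × ℕ | i.2.1 ∈ s}
      (fun i => (inner ℂ (v i) f : ℂ) * inner ℂ g (w i))) := by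
  have h := (tsum_enorm_cross_le s v w f g).trans_lt
    (ENNReal.add_lt_top.mpr ⟨hv.energy_lt_top hB s f, hw.energy_lt_top hB' s g⟩)
  refine Summable.of_norm ?_
  simpa using ENNReal.summable_toReal h.ne

theorem hasSum_cross {B B' : ℝ≥0∞} (hB : B ≠ ⊤) (hB' : B' ≠ ⊤) {v w : Fin L × ℤ × ℕ → L2 K}
    (hv : BesselBound B v) (hw : BesselBound B' w) (f g : L2 K) :
    HasSum (fun i => (inner ℂ (v i) f : ℂ) * inner ℂ g (w i)) (crossSum Set.univ v w f g) := by
  simpa [crossSum] using (summable_cross hB hB' hv hw Set.univ f g).hasSum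

theorem crossSum_add_compl {B B' : ℝ≥0∞} (hB : B ≠ ⊤) (hB' : B' ≠ ⊤)
    {v w : Fin L × ℤ × ℕ → L2 K} (hv : BesselBound B v) (hw : BesselBound B' w) (s : Set ℤ)
    (f g : L2 K) :
    crossSum s v w f g + crossSum sᶜ v w f g = crossSum Set.univ v w f g := by
  rw [crossSum, crossSum, crossSum, ← (summable_cross hB hB' hv hw s f g).tsum_add
    (summable_cross hB hB' hv hw sᶜ f g)]
  refine tsum_congr fun i => ?_
  by_cases hi : i.2.1 ∈ s <;> simp [Set.indicator, hi]

theorem hasSum_crossSum {B B' : ℝ≥0∞} (hB : B ≠ ⊤) (hB' : B' ≠ ⊤)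
    {v w : Fin L × ℤ × ℕ → L2 K} (hv : BesselBound B v) (hw : BesselBound B' w) (s : Set ℤ)
    (f g : L2 K) :
    HasSum (fun x : Fin L × ℤ => Set.indicator {x | x.2 ∈ s}
      (fun x => ∑' k, (inner ℂ (v (x.1, x.2, k)) f : ℂ) * inner ℂ g (w (x.1, x.2, k))) x)
      (crossSum s v w f g) := by
  have h := (Equiv.prodAssoc (Fin L) ℤ ℕ).hasSum_iff.mpr
    (summable_cross hB hB' hv hw s f g).hasSum
  have h2 := h.prod_fiberwise fun x => (h.summable.prod_factor x).hasSum
  refine h2.congr_fun fun x => ?_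
  by_cases hx : x.2 ∈ s <;> simp [Set.indicator, hx]

/-- On the scales `j ≥ -N` the quasi-affine energy is an average of affine energies. -/
theorem tsum_quasiAffine_eq_average (hϖ : IsPrimeElement (ϖ : K)) (hε : IsResidueBasis p ε)
    (ψ : L2 K) (f : L2 K) {j : ℤ} {N : ℕ} (hj : -(N : ℤ) ≤ j) :
    ∑' k, ‖(inner ℂ (quasiAffineElt p ϖ ε ψ j k) f : ℂ)‖ₑ ^ 2 =
      ((residueCard K : ℝ≥0∞) ^ N)⁻¹ * ∑ a ∈ Finset.range (residueCard K ^ N),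
        ∑' k, ‖(inner ℂ (affineElt p ϖ ε ψ j k) (translationOp (-u p ϖ ε a) f) : ℂ)‖ₑ ^ 2 := by
  have hq := residueCard_ne_zero K
  have hq' : (residueCard K : ℝ≥0∞) ≠ ⊤ := ENNReal.natCast_ne_top _
  have hqN : ∀ n : ℕ, (residueCard K : ℝ≥0∞) ^ n ≠ 0 := fun n => pow_ne_zero _ hq
  have hqN' : ∀ n : ℕ, (residueCard K : ℝ≥0∞) ^ n ≠ ⊤ := fun n => ENNReal.pow_ne_top hq'
  set H : K → ℝ≥0∞ := fun y =>
    ‖(inner ℂ (translationOp y (dilationOp ϖ j ψ)) f : ℂ)‖ₑ ^ 2 with hH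
  have hA : ∀ a k, ‖(inner ℂ (affineElt p ϖ ε ψ j k) (translationOp (-u p ϖ ε a) f) : ℂ)‖ₑ ^ 2 =
      H (((ϖ ^ j : Kˣ) : K) * u p ϖ ε k + u p ϖ ε a) := by
    intro a k
    rw [affineElt_eq hϖ hε, inner_translationOp_translationOp]
  simp_rw [hA]
  rcases le_or_gt 0 j with h0 | h0
  · obtain ⟨n, rfl⟩ := Int.eq_ofNat_of_zero_le h0
    have hQ : ∀ k, ‖(inner ℂ (quasiAffineElt p ϖ ε ψ (n : ℤ) k) f : ℂ)‖ₑ ^ 2 =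
        H ((ϖ : K) ^ n * u p ϖ ε k) := by
      intro k
      have := affineElt_eq hϖ hε ψ (n : ℤ) k
      rw [affineElt] at this
      rw [quasiAffineElt, if_pos h0, this, hH]
      simp
    simp_rw [hQ, zpow_natCast, Units.val_pow_eq_pow_val]
    rw [sum_tsum_u_dilate hϖ hε H n N, nsmul_eq_mul, Nat.cast_pow, ← mul_assoc,
      ENNReal.inv_mul_cancel (hqN N) (hqN' N), one_mul]
  · obtain ⟨m, rfl⟩ : ∃ m : ℕ, j = -(m : ℤ) := ⟨j.natAbs, by omega⟩
    have hm : m ≤ N := by omega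
    have hQ : ∀ k, ‖(inner ℂ (quasiAffineElt p ϖ ε ψ (-(m : ℤ)) k) f : ℂ)‖ₑ ^ 2 =
        ((residueCard K : ℝ≥0∞) ^ m)⁻¹ * H (u p ϖ ε k) := by
      intro k
      rw [quasiAffineElt, if_neg (not_le.mpr h0), inner_smul_left, enorm_mul, mul_pow,
        RCLike.enorm_conj, enorm_rpow_half_sq, ENNReal.zpow_neg, zpow_natCast]
    have hz : ((ϖ ^ (-(m : ℤ)) : Kˣ) : K) = (ϖ : K)⁻¹ ^ m := by simp
    simp_rw [hQ, hz]
    rw [ENNReal.tsum_mul_left, sum_tsum_u_contract hϖ hε H hm ENNReal.summable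
      fun _ => ENNReal.summable, nsmul_eq_mul, Nat.cast_pow, ← mul_assoc]
    -- The squared weight q^(-m) equals the multiplicity q^(N-m) divided by the number q^N of
    -- translates.
    congr 1
    obtain ⟨d, rfl⟩ := Nat.exists_eq_add_of_le hm
    rw [Nat.add_sub_cancel_left, pow_add, ENNReal.mul_inv (Or.inl (hqN m)) (Or.inl (hqN' m)),
      mul_assoc, ENNReal.inv_mul_cancel (hqN d) (hqN' d), mul_one]

theorem energy_quasiAffine_eq_average (hϖ : IsPrimeElement (ϖ : K)) (hε : IsResidueBasis p ε)
    (Ψ : Fin L → L2 K) (f : L2 K) {s : Set ℤ} {N : ℕ} (hs : s ⊆ Set.Ici (-(N : ℤ))) :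
    energy s (quasiAffineSystem p ϖ ε Ψ) f =
      ((residueCard K : ℝ≥0∞) ^ N)⁻¹ * ∑ a ∈ Finset.range (residueCard K ^ N),
        energy s (affineSystem p ϖ ε Ψ) (translationOp (-u p ϖ ε a) f) := by
  simp_rw [energy_eq_tsum]
  rw [← Summable.tsum_finsetSum fun _ _ => ENNReal.summable, ← ENNReal.tsum_mul_left]
  refine tsum_congr fun x => ?_
  by_cases hx : x.2 ∈ s
  · simp only [Set.indicator, Set.mem_ofPred_eq, hx, if_true]
    exact tsum_quasiAffine_eq_average hϖ hε (Ψ x.1) f (hs hx)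
  · simp [Set.indicator, hx]

/-- Every truncation to j ≥ -N is an average of affine energies of functions of norm ‖f‖, so the
same constant B works. -/
theorem BesselBound.quasiAffine (hϖ : IsPrimeElement (ϖ : K)) (hε : IsResidueBasis p ε)
    {Ψ : Fin L → L2 K} {B : ℝ≥0∞} (h : BesselBound B (affineSystem p ϖ ε Ψ)) :
    BesselBound B (quasiAffineSystem p ϖ ε Ψ) := by
  have hq := residueCard_ne_zero K
  have hq' : (residueCard K : ℝ≥0∞) ≠ ⊤ := ENNReal.natCast_ne_top _
  intro f
  have hN : ∀ N : ℕ, energy (Set.Ici (-(N : ℤ))) (quasiAffineSystem p ϖ ε Ψ) f ≤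
      B * ‖f‖ₑ ^ 2 := by
    intro N
    rw [energy_quasiAffine_eq_average hϖ hε Ψ f subset_rfl]
    calc _ ≤ ((residueCard K : ℝ≥0∞) ^ N)⁻¹ * ∑ a ∈ Finset.range (residueCard K ^ N),
          B * ‖f‖ₑ ^ 2 := by
          gcongr with a
          refine (energy_mono (Set.subset_univ _) _ _).trans ((h _).trans_eq ?_)
          rw [← ofReal_norm (translationOp _ f), norm_translationOp, ofReal_norm]
      _ = B * ‖f‖ₑ ^ 2 := by
          rw [Finset.sum_const, Finset.card_range, nsmul_eq_mul, Nat.cast_pow, ← mul_assoc,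
            ENNReal.inv_mul_cancel (pow_ne_zero _ hq) (ENNReal.pow_ne_top hq'), one_mul]
  rw [energy, ENNReal.tsum_eq_iSup_sum]
  refine iSup_le fun t => ?_
  -- A finite set of indices involves finitely many scales, hence lies in one truncation.
  refine le_trans ?_ (hN (t.sup fun i => i.2.1.natAbs))
  refine le_trans (Finset.sum_le_sum fun i hi => ?_) (ENNReal.sum_le_tsum t)
  have : i.2.1.natAbs ≤ t.sup fun i => i.2.1.natAbs := Finset.le_sup (f := fun i : Fin L × ℤ × ℕ =>
    i.2.1.natAbs) hi
  have hmem : i.2.1 ∈ Set.Ici (-((t.sup fun i => i.2.1.natAbs : ℕ) : ℤ)) := by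
    rw [Set.mem_Ici]; omega
  simp only [Set.indicator, Set.mem_ofPred_eq, hmem, Set.mem_univ, if_true, le_refl]

/-- Same averaging as for energies. The Bessel bounds are needed only for the summability that
splitting a complex series over cosets requires. -/
theorem tsum_quasiAffine_cross_eq_average (hϖ : IsPrimeElement (ϖ : K))
    (hε : IsResidueBasis p ε) {B B' : ℝ≥0∞} (hB : B ≠ ⊤) (hB' : B' ≠ ⊤) {Ψ Φ : Fin L → L2 K}
    (hΨ : BesselBound B (affineSystem p ϖ ε Ψ)) (hΦ : BesselBound B' (affineSystem p ϖ ε Φ))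
    (f g : L2 K) (l : Fin L) {j : ℤ} {N : ℕ} (hj : -(N : ℤ) ≤ j) :
    ∑' k, (inner ℂ (quasiAffineElt p ϖ ε (Ψ l) j k) f : ℂ) *
        inner ℂ g (quasiAffineElt p ϖ ε (Φ l) j k) =
      ((residueCard K : ℂ) ^ N)⁻¹ * ∑ a ∈ Finset.range (residueCard K ^ N),
        ∑' k, (inner ℂ (affineElt p ϖ ε (Ψ l) j k) (translationOp (-u p ϖ ε a) f) : ℂ) *
          inner ℂ (translationOp (-u p ϖ ε a) g) (affineElt p ϖ ε (Φ l) j k) := by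
  have hq : (residueCard K : ℂ) ≠ 0 := by
    exact_mod_cast (zero_lt_one.trans (one_lt_residueCard K)).ne'
  set H : K → ℂ := fun y => (inner ℂ (translationOp y (dilationOp ϖ j (Ψ l))) f : ℂ) *
    inner ℂ g (translationOp y (dilationOp ϖ j (Φ l))) with hH
  have hA : ∀ a k, (inner ℂ (affineElt p ϖ ε (Ψ l) j k) (translationOp (-u p ϖ ε a) f) : ℂ) *
        inner ℂ (translationOp (-u p ϖ ε a) g) (affineElt p ϖ ε (Φ l) j k) =
      H (((ϖ ^ j : Kˣ) : K) * u p ϖ ε k + u p ϖ ε a) := by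
    intro a k
    rw [affineElt_eq hϖ hε, affineElt_eq hϖ hε, inner_translationOp_translationOp,
      inner_translationOp_translationOp']
  have hsA : ∀ a, Summable fun k => H (((ϖ ^ j : Kˣ) : K) * u p ϖ ε k + u p ϖ ε a) := by
    intro a
    have h := summable_cross hB hB' hΨ hΦ Set.univ (translationOp (-u p ϖ ε a) f)
      (translationOp (-u p ϖ ε a) g)
    have h2 := h.comp_injective (i := fun k : ℕ => (l, j, k)) fun k k' hk => by simpa using hk
    refine h2.congr fun k => ?_
    simp only [Function.comp_apply, Set.mem_univ, Set.ofPred_true, Set.indicator_univ]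
    exact hA a k
  have hsQ : Summable fun k => (inner ℂ (quasiAffineElt p ϖ ε (Ψ l) j k) f : ℂ) *
        inner ℂ g (quasiAffineElt p ϖ ε (Φ l) j k) := by
    have h := summable_cross hB hB' (hΨ.quasiAffine hϖ hε) (hΦ.quasiAffine hϖ hε) Set.univ f g
    have h2 := h.comp_injective (i := fun k : ℕ => (l, j, k)) fun k k' hk => by simpa using hk
    refine h2.congr fun k => ?_
    simp [quasiAffineSystem]
  simp_rw [hA]
  rcases le_or_gt 0 j with h0 | h0
  · obtain ⟨n, rfl⟩ := Int.eq_ofNat_of_zero_le h0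
    have hQ : ∀ k, (inner ℂ (quasiAffineElt p ϖ ε (Ψ l) (n : ℤ) k) f : ℂ) *
        inner ℂ g (quasiAffineElt p ϖ ε (Φ l) (n : ℤ) k) = H ((ϖ : K) ^ n * u p ϖ ε k) := by
      intro k
      have h1 := affineElt_eq hϖ hε (Ψ l) (n : ℤ) k
      have h2 := affineElt_eq hϖ hε (Φ l) (n : ℤ) k
      rw [affineElt] at h1 h2
      rw [quasiAffineElt, quasiAffineElt, if_pos h0, if_pos h0, h1, h2, hH]
      simp
    simp_rw [hQ, zpow_natCast, Units.val_pow_eq_pow_val]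
    rw [sum_tsum_u_dilate hϖ hε H n N, nsmul_eq_mul, Nat.cast_pow, ← mul_assoc,
      inv_mul_cancel₀ (pow_ne_zero _ hq), one_mul]
  · obtain ⟨m, rfl⟩ : ∃ m : ℕ, j = -(m : ℤ) := ⟨j.natAbs, by omega⟩
    have hm : m ≤ N := by omega
    have hQ : ∀ k, (inner ℂ (quasiAffineElt p ϖ ε (Ψ l) (-(m : ℤ)) k) f : ℂ) *
        inner ℂ g (quasiAffineElt p ϖ ε (Φ l) (-(m : ℤ)) k) =
          ((residueCard K : ℂ) ^ m)⁻¹ * H (u p ϖ ε k) := by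
      intro k
      rw [quasiAffineElt, quasiAffineElt, if_neg (not_le.mpr h0), if_neg (not_le.mpr h0),
        inner_smul_left, inner_smul_right, Complex.conj_ofReal, mul_mul_mul_comm,
        ← Complex.ofReal_mul, rpow_half_mul_self]
      simp [hH]
    have hz : ((ϖ ^ (-(m : ℤ)) : Kˣ) : K) = (ϖ : K)⁻¹ ^ m := by simp
    simp_rw [hQ] at hsQ
    simp_rw [hz] at hsA
    simp_rw [hQ, hz]
    rw [tsum_mul_left, sum_tsum_u_contract hϖ hε H hm
      ((summable_mul_left_iff (inv_ne_zero (pow_ne_zero m hq))).mp hsQ) hsA, nsmul_eq_mul,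
      Nat.cast_pow, ← mul_assoc]
    congr 1
    obtain ⟨d, rfl⟩ := Nat.exists_eq_add_of_le hm
    rw [Nat.add_sub_cancel_left, pow_add]
    field_simp

theorem crossSum_quasiAffine_eq_average (hϖ : IsPrimeElement (ϖ : K))
    (hε : IsResidueBasis p ε) {B B' : ℝ≥0∞} (hB : B ≠ ⊤) (hB' : B' ≠ ⊤) {Ψ Φ : Fin L → L2 K}
    (hΨ : BesselBound B (affineSystem p ϖ ε Ψ)) (hΦ : BesselBound B' (affineSystem p ϖ ε Φ))
    (f g : L2 K) {s : Set ℤ} {N : ℕ} (hs : s ⊆ Set.Ici (-(N : ℤ))) :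
    crossSum s (quasiAffineSystem p ϖ ε Ψ) (quasiAffineSystem p ϖ ε Φ) f g =
      ((residueCard K : ℂ) ^ N)⁻¹ * ∑ a ∈ Finset.range (residueCard K ^ N),
        crossSum s (affineSystem p ϖ ε Ψ) (affineSystem p ϖ ε Φ)
          (translationOp (-u p ϖ ε a) f) (translationOp (-u p ϖ ε a) g) := by
  have h1 := hasSum_crossSum hB hB' (hΨ.quasiAffine hϖ hε) (hΦ.quasiAffine hϖ hε) s f g
  have h2 := (hasSum_sum fun a (_ : a ∈ Finset.range (residueCard K ^ N)) =>
    hasSum_crossSum hB hB' hΨ hΦ s (translationOp (-u p ϖ ε a) f)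
      (translationOp (-u p ϖ ε a) g)).mul_left (((residueCard K : ℂ) ^ N)⁻¹)
  refine h1.unique (h2.congr_fun fun x => ?_)
  by_cases hx : x.2 ∈ s
  · simp only [Set.indicator, Set.mem_ofPred_eq, hx, if_true]
    exact tsum_quasiAffine_cross_eq_average hϖ hε hB hB' hΨ hΦ f g x.1 (hs hx)
  · simp [Set.indicator, hx]

end Systems

/-! ### Averaged affine energies at the scales below -N. -/

section Remainder

open scoped ENNReal
open Filter Topology

variable {K : Type*} [Field K] [ValuativeRel K] [TopologicalSpace K] [IsNonarchimedeanLocalField K]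
  {p : ℕ} [Fact p.Prime] [CharP K p] {c : ℕ} {ϖ : Kˣ} {ε : Fin c → 𝒪[K]}
  [MeasurableSpace K] [BorelSpace K] {L : ℕ}

theorem enorm_translationOp (y : K) (f : L2 K) : ‖translationOp y f‖ₑ = ‖f‖ₑ := by
  rw [← ofReal_norm, norm_translationOp, ofReal_norm]

theorem valuation_zpow (ϖ : Kˣ) (j : ℤ) :
    valuation K ((ϖ ^ j : Kˣ) : K) = valuation K (ϖ : K) ^ j := by
  rw [Units.val_zpow_eq_zpow_val, map_zpow₀]

/-- The translates and dilates of the unit ball meeting a given shell are disjoint. -/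
theorem shell_index_unique (hϖ : IsPrimeElement (ϖ : K)) (hε : IsResidueBasis p ε)
    {N i a a' k k' : ℕ} {j j' : ℤ} {x y : K} (hi : i < N) (hj : j < -(N : ℤ))
    (hj' : j' < -(N : ℤ))
    (ha : valuation K (u p ϖ ε a - y) = valuation K (ϖ : K)⁻¹ ^ (i + 1))
    (ha' : valuation K (u p ϖ ε a' - y) = valuation K (ϖ : K)⁻¹ ^ (i + 1))
    (hx : valuation K (((ϖ ^ j : Kˣ) : K) * (x + u p ϖ ε k) + (u p ϖ ε a - y)) ≤ 1)
    (hx' : valuation K (((ϖ ^ j' : Kˣ) : K) * (x + u p ϖ ε k') + (u p ϖ ε a' - y)) ≤ 1) :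
    a = a' ∧ j = j' ∧ k = k' := by
  have hp : 0 < p := (Fact.out : p.Prime).pos
  set π := valuation K (ϖ : K) with hπ
  have hπ0 : 0 < π := valuation_unit_pos ϖ
  have hπ1 : π < 1 := hϖ.1
  have hρ : (1 : ValueGroupWithZero K) < valuation K (ϖ : K)⁻¹ ^ (i + 1) :=
    one_lt_pow₀ hϖ.one_lt_inv (by omega)
  -- As |u(a) - y| > 1, the ultrametric inequality forces |ϖ^j (x + u(k))| = |u(a) - y|, which
  -- determines |x + u(k)| from j and i.
  have hval : ∀ {a k : ℕ} {j : ℤ},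
      valuation K (u p ϖ ε a - y) = valuation K (ϖ : K)⁻¹ ^ (i + 1) →
      valuation K (((ϖ ^ j : Kˣ) : K) * (x + u p ϖ ε k) + (u p ϖ ε a - y)) ≤ 1 →
      valuation K (x + u p ϖ ε k) = π ^ (-j - ((i : ℤ) + 1)) := by
    intro a k j ha hx
    have h1 : valuation K (((ϖ ^ j : Kˣ) : K) * (x + u p ϖ ε k)) =
        valuation K (ϖ : K)⁻¹ ^ (i + 1) := by
      have e : ((ϖ ^ j : Kˣ) : K) * (x + u p ϖ ε k) =
          (((ϖ ^ j : Kˣ) : K) * (x + u p ϖ ε k) + (u p ϖ ε a - y)) - (u p ϖ ε a - y) := by ring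
      rw [e, Valuation.map_sub_eq_of_lt_right, ha]
      rw [ha]
      exact hx.trans_lt hρ
    rw [map_mul, valuation_zpow, map_inv₀, ← hπ] at h1
    rw [sub_eq_add_neg, zpow_add₀ hπ0.ne', zpow_neg, zpow_neg, ← Int.natCast_succ, zpow_natCast,
      ← inv_pow, ← h1, inv_mul_cancel_left₀ (zpow_ne_zero _ hπ0.ne')]
  -- From j < -N and i < N the exponent is positive, so x + u(k) ∈ 𝔇. This fixes k; then |x + u(k)|
  -- fixes j, and finally the coset fixes a.
  have hle : ∀ {k : ℕ} {j : ℤ}, j < -(N : ℤ) →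
      valuation K (x + u p ϖ ε k) = π ^ (-j - ((i : ℤ) + 1)) →
      valuation K (x + u p ϖ ε k) ≤ 1 := by
    intro k j hj h
    obtain ⟨n, hn⟩ := Int.eq_ofNat_of_zero_le (show 0 ≤ -j - ((i : ℤ) + 1) by omega)
    rw [h, hn, zpow_natCast]
    exact pow_le_one₀ hπ0.le hπ1.le
  have h1 := hval ha hx
  have h2 := hval ha' hx'
  have hk : k = k' := by
    refine eq_of_valuation_u_sub_le_one hp hϖ hε ?_
    have := Valuation.map_sub_le (valuation K) (hle hj h1) (hle hj' h2)
    rwa [add_sub_add_left_eq_sub] at this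
  subst hk
  have hjj : j = j' := by
    have := zpow_right_injective₀ hπ0 hπ1.ne (h1.symm.trans h2)
    omega
  subst hjj
  refine ⟨eq_of_valuation_u_sub_le_one hp hϖ hε ?_, rfl, rfl⟩
  have := Valuation.map_sub_le (valuation K) hx hx'
  rwa [add_sub_add_left_eq_sub, sub_sub_sub_cancel_right] at this

/-- Localized Cauchy–Schwarz, with the operators moved off ψ: the dependence on j, k and z now sits
in the set where |ψ|² is integrated. -/
theorem enorm_inner_affineElt_sq_le (hϖ : IsPrimeElement (ϖ : K)) (hε : IsResidueBasis p ε)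
    {f : L2 K} {y : K} (hf : VanishesOff {x | valuation K (x - y) ≤ 1} f) (ψ : L2 K) (j : ℤ)
    (k : ℕ) (z : K) :
    ‖(inner ℂ (affineElt p ϖ ε ψ j k) (translationOp (-z) f) : ℂ)‖ₑ ^ 2 ≤
      ‖f‖ₑ ^ 2 *
        mass ψ {x | valuation K (((ϖ ^ j : Kˣ) : K) * (x + u p ϖ ε k) + (z - y)) ≤ 1} := by
  have hS : MeasurableSet {x : K | valuation K (x + (z - y)) ≤ 1} := by
    simpa using measurableSet_affine_integers (1 : K) (z - y)
  have hS' : MeasurableSet {x : K | valuation K (((ϖ ^ j : Kˣ) : K) * x + (z - y)) ≤ 1} :=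
    measurableSet_affine_integers _ _
  have hv : VanishesOff {x | valuation K (x + (z - y)) ≤ 1} (translationOp (-z) f) := by
    refine (hf.translationOp (-z)).mono fun x hx => ?_
    have hx : valuation K (x - -z - y) ≤ 1 := hx
    rwa [sub_neg_eq_add, add_sub_assoc] at hx
  refine (enorm_inner_sq_le_mass hS hv _).trans_eq ?_
  rw [enorm_translationOp, affineElt, mass_dilationOp (Fact.out : p.Prime).pos hϖ hε _ _ hS]
  exact congrArg _ (mass_translationOp _ _ hS')

/-- Each a ≠ b lies in one of N shells around u(b), and in each shell the sets carrying |ψ|² are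
disjoint over all (a, j, k), so their masses add up to at most ‖ψ‖². -/
theorem sum_tsum_shell_le (hϖ : IsPrimeElement (ϖ : K)) (hε : IsResidueBasis p ε)
    {f : L2 K} {b N : ℕ} (hb : b < residueCard K ^ N)
    (hf : VanishesOff {x | valuation K (x - u p ϖ ε b) ≤ 1} f) (ψ : L2 K) :
    ∑ a ∈ (Finset.range (residueCard K ^ N)).erase b, ∑' x : ℤ × ℕ,
      Set.indicator {x | x.1 < -(N : ℤ)} (fun x => ‖(inner ℂ (affineElt p ϖ ε ψ x.1 x.2)
        (translationOp (-u p ϖ ε a) f) : ℂ)‖ₑ ^ 2) x ≤ ‖f‖ₑ ^ 2 * (N * ‖ψ‖ₑ ^ 2) := by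
  have hp : 0 < p := (Fact.out : p.Prime).pos
  -- The conditions on the scale and the shell are built into the set, which is empty when they
  -- fail; disjointness then holds over all triples y = (a, j, k).
  set A : ℕ → ℕ × ℤ × ℕ → Set K := fun i y => {x |
    (y.2.1 < -(N : ℤ) ∧ valuation K (u p ϖ ε y.1 - u p ϖ ε b) = valuation K (ϖ : K)⁻¹ ^ (i + 1)) ∧
      valuation K (((ϖ ^ y.2.1 : Kˣ) : K) * (x + u p ϖ ε y.2.2) +
        (u p ϖ ε y.1 - u p ϖ ε b)) ≤ 1} with hA
  have hAm : ∀ i y, MeasurableSet (A i y) := by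
    intro i y
    have : MeasurableSet {x : K | valuation K (((ϖ ^ y.2.1 : Kˣ) : K) * (x + u p ϖ ε y.2.2) +
        (u p ϖ ε y.1 - u p ϖ ε b)) ≤ 1} := by
      simpa only [mul_add, add_assoc] using measurableSet_affine_integers ((ϖ ^ y.2.1 : Kˣ) : K)
        (((ϖ ^ y.2.1 : Kˣ) : K) * u p ϖ ε y.2.2 + (u p ϖ ε y.1 - u p ϖ ε b))
    exact (MeasurableSet.const _).inter this
  have hAd : ∀ i < N, Pairwise (Function.onFun Disjoint (A i)) := by
    intro i hi y y' hne
    refine Set.disjoint_left.mpr fun x hx hx' => hne ?_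
    obtain ⟨h1, h2, h3⟩ := shell_index_unique hϖ hε hi hx.1.1 hx'.1.1 hx.1.2 hx'.1.2 hx.2 hx'.2
    exact Prod.ext h1 (Prod.ext h2 h3)
  have hAs : ∀ i < N, ∑' y, mass ψ (A i y) ≤ ‖ψ‖ₑ ^ 2 := by
    intro i hi
    rw [← mass_univ]
    exact tsum_measure_le_measure_univ (fun y => (hAm i y).nullMeasurableSet)
      fun y y' h => (hAd i hi h).aedisjoint
  have hterm : ∀ a ∈ (Finset.range (residueCard K ^ N)).erase b, ∑' x : ℤ × ℕ,
      Set.indicator {x | x.1 < -(N : ℤ)} (fun x => ‖(inner ℂ (affineElt p ϖ ε ψ x.1 x.2)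
        (translationOp (-u p ϖ ε a) f) : ℂ)‖ₑ ^ 2) x ≤
      ∑ i ∈ Finset.range N, ∑' x : ℤ × ℕ, ‖f‖ₑ ^ 2 * mass ψ (A i (a, x)) := by
    intro a ha
    rw [Finset.mem_erase, Finset.mem_range] at ha
    obtain ⟨i, hi, hv⟩ := exists_valuation_u_sub hp hϖ hε ha.2 hb ha.1
    refine le_trans ?_ (Finset.single_le_sum (f := fun i => ∑' x : ℤ × ℕ,
      ‖f‖ₑ ^ 2 * mass ψ (A i (a, x))) (fun _ _ => zero_le) (Finset.mem_range.mpr hi))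
    refine ENNReal.tsum_le_tsum fun x => ?_
    by_cases hx : x.1 < -(N : ℤ)
    · simp only [Set.indicator, Set.mem_ofPred_eq, hx, if_true]
      refine (enorm_inner_affineElt_sq_le hϖ hε hf ψ x.1 x.2 _).trans_eq ?_
      simp only [hA, hx, hv, true_and]
    · simp [Set.indicator, hx]
  refine (Finset.sum_le_sum hterm).trans ?_
  rw [Finset.sum_comm]
  calc _ ≤ ∑ i ∈ Finset.range N, ‖f‖ₑ ^ 2 * ‖ψ‖ₑ ^ 2 := by
        refine Finset.sum_le_sum fun i hi => ?_
        simp_rw [ENNReal.tsum_mul_left]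
        rw [← Finset.mul_sum]
        gcongr
        refine (ENNReal.sum_le_tsum _).trans ?_
        rw [← ENNReal.tsum_prod]
        exact hAs i (Finset.mem_range.mp hi)
    _ = _ := by
        rw [Finset.sum_const, Finset.card_range, nsmul_eq_mul]
        ring

theorem energy_eq_sum (s : Set ℤ) (v : Fin L × ℤ × ℕ → L2 K) (f : L2 K) :
    energy s v f = ∑ l, ∑' x : ℤ × ℕ, Set.indicator {x | x.1 ∈ s}
      (fun x => ‖(inner ℂ (v (l, x)) f : ℂ)‖ₑ ^ 2) x := by
  rw [energy, ENNReal.tsum_prod', tsum_fintype]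
  rfl

theorem sum_energy_translates_le (hϖ : IsPrimeElement (ϖ : K)) (hε : IsResidueBasis p ε)
    {Ψ : Fin L → L2 K} {B : ℝ≥0∞} (hΨ : BesselBound B (affineSystem p ϖ ε Ψ))
    {f : L2 K} {b N : ℕ} (hb : b < residueCard K ^ N)
    (hf : VanishesOff {x | valuation K (x - u p ϖ ε b) ≤ 1} f) :
    ∑ a ∈ Finset.range (residueCard K ^ N), energy (Set.Iio (-(N : ℤ)))
      (affineSystem p ϖ ε Ψ) (translationOp (-u p ϖ ε a) f) ≤
      ‖f‖ₑ ^ 2 * (B + N * ∑ l, ‖Ψ l‖ₑ ^ 2) := by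
  rw [← Finset.add_sum_erase _ _ (Finset.mem_range.mpr hb), mul_add]
  gcongr
  · refine ((energy_mono (Set.subset_univ _) _ _).trans (hΨ _)).trans_eq ?_
    rw [enorm_translationOp, mul_comm]
  · simp_rw [energy_eq_sum]
    rw [Finset.sum_comm, Finset.mul_sum, Finset.mul_sum]
    exact Finset.sum_le_sum fun l _ => sum_tsum_shell_le hϖ hε hb hf (Ψ l)

theorem tendsto_succ_div_pow : Tendsto
    (fun N : ℕ => ((residueCard K : ℝ≥0∞) ^ N)⁻¹ * (N + 1 : ℝ≥0∞)) atTop (𝓝 0) := by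
  have hq : 1 < (residueCard K : ℝ) := by exact_mod_cast one_lt_residueCard K
  have hr : (residueCard K : ℝ)⁻¹ < 1 := inv_lt_one_of_one_lt₀ hq
  have hr0 : 0 ≤ (residueCard K : ℝ)⁻¹ := by positivity
  have h1 := (tendsto_self_mul_const_pow_of_lt_one hr0 hr).add
    (tendsto_pow_atTop_nhds_zero_of_lt_one hr0 hr)
  have h2 := ENNReal.tendsto_ofReal h1
  rw [add_zero, ENNReal.ofReal_zero] at h2
  refine h2.congr fun N => ?_
  rw [← add_one_mul, mul_comm, ENNReal.ofReal_mul (by positivity),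
    ENNReal.ofReal_pow hr0, ENNReal.ofReal_inv_of_pos (by linarith), ENNReal.ofReal_natCast,
    ENNReal.ofReal_add (by positivity) (by norm_num), ENNReal.ofReal_natCast, ENNReal.ofReal_one,
    ENNReal.inv_pow]

/-- The averages of the energies at the scales below `-N` vanish in the limit. -/
theorem tendsto_average_energy (hϖ : IsPrimeElement (ϖ : K)) (hε : IsResidueBasis p ε)
    {Ψ : Fin L → L2 K} {B : ℝ≥0∞} (hB : B ≠ ⊤) (hΨ : BesselBound B (affineSystem p ϖ ε Ψ))
    {f : L2 K} {b : ℕ} (hf : VanishesOff {x | valuation K (x - u p ϖ ε b) ≤ 1} f) :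
    Tendsto (fun N : ℕ => ((residueCard K : ℝ≥0∞) ^ N)⁻¹ *
      ∑ a ∈ Finset.range (residueCard K ^ N), energy (Set.Iio (-(N : ℤ)))
        (affineSystem p ϖ ε Ψ) (translationOp (-u p ϖ ε a) f)) atTop (𝓝 0) := by
  set C : ℝ≥0∞ := ‖f‖ₑ ^ 2 * (B + ∑ l, ‖Ψ l‖ₑ ^ 2) with hC
  have hCt : C ≠ ⊤ := by
    refine ENNReal.mul_ne_top (ENNReal.pow_ne_top enorm_ne_top) (ENNReal.add_ne_top.mpr ⟨hB, ?_⟩)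
    exact ENNReal.sum_ne_top.mpr fun l _ => ENNReal.pow_ne_top enorm_ne_top
  have h1 := ENNReal.Tendsto.mul_const (b := C) (tendsto_succ_div_pow (K := K)) (Or.inr hCt)
  rw [zero_mul] at h1
  refine tendsto_of_tendsto_of_tendsto_of_le_of_le' tendsto_const_nhds h1
    (Eventually.of_forall fun _ => zero_le) ?_
  filter_upwards [eventually_ge_atTop b] with N hN
  have hb : b < residueCard K ^ N := (Nat.lt_pow_self (one_lt_residueCard K)).trans_le
    (Nat.pow_le_pow_right (one_lt_residueCard K).le hN)
  rw [mul_assoc]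
  gcongr
  refine (sum_energy_translates_le hϖ hε hΨ hb hf).trans ?_
  -- What remains is B + N S ≤ (N + 1)(B + S) with S = Σ‖ψ^l‖².
  rw [hC, mul_left_comm]
  gcongr
  refine le_of_le_of_eq (le_add_self (b := N * B + ∑ l, ‖Ψ l‖ₑ ^ 2)) ?_
  ring

end Remainder

/-! ### Reduction to functions supported in a single coset of 𝔇. -/

section Density

open scoped ENNReal
open Filter Topology

variable {K : Type*} [Field K] [ValuativeRel K] [TopologicalSpace K] [IsNonarchimedeanLocalField K]
  {p : ℕ} [Fact p.Prime] [CharP K p] {c : ℕ} {ϖ : Kˣ} {ε : Fin c → 𝒪[K]}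
  [MeasurableSpace K] [BorelSpace K] {L : ℕ}

/-- The functions supported in one of the cosets `u(b) + 𝔇`. -/
def cosetFunctions (p : ℕ) {c : ℕ} (ϖ : Kˣ) (ε : Fin c → 𝒪[K]) : Set (L2 K) :=
  {f | ∃ b, VanishesOff {x | valuation K (x - u p ϖ ε b) ≤ 1} f}

theorem measurableSet_coset (y : K) : MeasurableSet {x : K | valuation K (x - y) ≤ 1} := by
  simpa [sub_eq_add_neg] using measurableSet_affine_integers (1 : K) (-y)

/-- A function orthogonal to its own restriction to u(b) + 𝔇 vanishes there, and the countably many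
cosets cover K. -/
theorem topologicalClosure_span_cosetFunctions (hϖ : IsPrimeElement (ϖ : K))
    (hε : IsResidueBasis p ε) :
    (Submodule.span ℂ (cosetFunctions p ϖ ε)).topologicalClosure = ⊤ := by
  rw [Submodule.topologicalClosure_eq_top_iff, Submodule.eq_bot_iff]
  intro f hf
  have hS := fun b : ℕ => measurableSet_coset (u p ϖ ε b)
  have hb : ∀ b : ℕ, ∀ᵐ x ∂haar K, valuation K (x - u p ϖ ε b) ≤ 1 → f x = 0 := by
    intro b
    set S := {x : K | valuation K (x - u p ϖ ε b) ≤ 1} with hSdef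
    set g : L2 K := ((Lp.memLp f).indicator (hS b)).toLp with hg
    have hgf : g =ᵐ[haar K] S.indicator f := MemLp.coeFn_toLp _
    have hgS : g ∈ cosetFunctions p ϖ ε := by
      refine ⟨b, ?_⟩
      filter_upwards [hgf] with x hx hxS
      rw [hx, Set.indicator_of_notMem (show x ∉ S from hxS)]
    have h0 : inner ℂ g f = (0 : ℂ) :=
      (Submodule.mem_orthogonal _ _).mp hf g (Submodule.subset_span hgS)
    have h1 : inner ℂ g f = (inner ℂ g g : ℂ) := by
      rw [L2.inner_def, L2.inner_def]
      refine integral_congr_ae ?_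
      filter_upwards [hgf] with x hx
      rw [hx]
      by_cases hxS : x ∈ S <;> simp [hxS]
    rw [h1, inner_self_eq_zero] at h0
    have h2 : g =ᵐ[haar K] 0 := by rw [h0]; exact Lp.coeFn_zero _ _ _
    filter_upwards [hgf, h2] with x hx hx2 hxS
    rw [Set.indicator_of_mem (show x ∈ S from hxS), hx2] at hx
    exact hx.symm
  refine Lp.ext ?_
  filter_upwards [ae_all_iff.mpr hb, Lp.coeFn_zero ℂ 2 (haar K)] with x hx hx0
  obtain ⟨b, hb⟩ := exists_u_near hϖ hε x
  rw [hx b hb, hx0]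
  rfl

theorem crossSum_conj (v w : Fin L × ℤ × ℕ → L2 K) (s : Set ℤ) (f g : L2 K) :
    crossSum s v w f g = starRingEnd ℂ (crossSum s w v g f) := by
  rw [crossSum, crossSum, Complex.conj_tsum]
  refine tsum_congr fun i => ?_
  by_cases hi : i.2.1 ∈ s <;> simp [Set.indicator, hi, mul_comm]

theorem crossSum_eq_inner_of_cosetFunctions_left (hϖ : IsPrimeElement (ϖ : K))
    (hε : IsResidueBasis p ε) {B B' : ℝ≥0∞} (hB : B ≠ ⊤) (hB' : B' ≠ ⊤)
    {v w : Fin L × ℤ × ℕ → L2 K} (hv : BesselBound B v) (hw : BesselBound B' w) (g : L2 K)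
    (h : ∀ f ∈ cosetFunctions p ϖ ε, crossSum Set.univ v w f g = inner ℂ g f) (f : L2 K) :
    crossSum Set.univ v w f g = inner ℂ g f := by
  let T : L2 K →ₗ[ℂ] ℂ :=
    { toFun := fun f => crossSum Set.univ v w f g
      map_add' := fun f f' => by
        refine (hasSum_cross hB hB' hv hw (f + f') g).unique ?_
        refine ((hasSum_cross hB hB' hv hw f g).add
          (hasSum_cross hB hB' hv hw f' g)).congr_fun fun i => ?_
        rw [inner_add_right, add_mul]
      map_smul' := fun a f => by
        refine (hasSum_cross hB hB' hv hw (a • f) g).unique ?_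
        refine ((hasSum_cross hB hB' hv hw f g).mul_left a).congr_fun fun i => ?_
        rw [inner_smul_right, mul_assoc] }
  -- The estimate of a bilinear sum by energies is not homogeneous in f, but a bound on the unit
  -- ball already makes a linear functional continuous.
  have hbound : ∀ f ∈ Metric.closedBall (0 : L2 K) 1, ‖T f‖ ≤ (B + B' * ‖g‖ₑ ^ 2).toReal := by
    intro f hf
    have hf1 : ‖f‖ₑ ≤ 1 := by
      rw [mem_closedBall_zero_iff] at hf
      rw [← ofReal_norm, ← ENNReal.ofReal_one]
      exact ENNReal.ofReal_le_ofReal hf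
    have h1 : ‖T f‖ₑ ≤ B + B' * ‖g‖ₑ ^ 2 := by
      refine (enorm_crossSum_le _ _ _ _ _).trans (add_le_add ((hv f).trans ?_) (hw g))
      calc B * ‖f‖ₑ ^ 2 ≤ B * 1 ^ 2 := by gcongr
        _ = B := by simp
    rw [← toReal_enorm]
    exact ENNReal.toReal_mono (ENNReal.add_ne_top.mpr
      ⟨hB, ENNReal.mul_ne_top hB' (ENNReal.pow_ne_top enorm_ne_top)⟩) h1
  have hT : Continuous T := (T.mkContinuous _
    (LinearMap.bound_of_ball_bound' one_pos _ T hbound)).continuous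
  have hset : {f | T f = inner ℂ g f} = Set.univ := by
    refine Set.eq_univ_of_univ_subset ?_
    have hcl : IsClosed {f : L2 K | T f = inner ℂ g f} :=
      isClosed_eq hT (continuous_const.inner continuous_id)
    have hsub : (Submodule.span ℂ (cosetFunctions p ϖ ε)) ≤
        LinearMap.ker (T - (innerSL ℂ g).toLinearMap) := by
      rw [Submodule.span_le]
      intro f hf
      simp only [SetLike.mem_coe, LinearMap.mem_ker, LinearMap.sub_apply, sub_eq_zero]
      exact h f hf
    have := topologicalClosure_span_cosetFunctions hϖ hε (p := p)
    rw [← Submodule.top_coe (R := ℂ), ← this, Submodule.topologicalClosure_coe]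
    refine hcl.closure_subset_iff.mpr fun f hf => ?_
    have := hsub hf
    rwa [LinearMap.mem_ker, LinearMap.sub_apply, sub_eq_zero] at this
  exact (hset ▸ Set.mem_univ f : f ∈ {f | T f = inner ℂ g f})

/-- The reproducing identity extends from functions supported in cosets to all of `L²`. -/
theorem crossSum_eq_inner_of_cosetFunctions (hϖ : IsPrimeElement (ϖ : K))
    (hε : IsResidueBasis p ε) {B B' : ℝ≥0∞} (hB : B ≠ ⊤) (hB' : B' ≠ ⊤)
    {v w : Fin L × ℤ × ℕ → L2 K} (hv : BesselBound B v) (hw : BesselBound B' w)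
    (h : ∀ f ∈ cosetFunctions p ϖ ε, ∀ g ∈ cosetFunctions p ϖ ε,
      crossSum Set.univ v w f g = inner ℂ g f) (f g : L2 K) :
    crossSum Set.univ v w f g = inner ℂ g f := by
  refine crossSum_eq_inner_of_cosetFunctions_left hϖ hε hB hB' hv hw g (fun f hf => ?_) f
  rw [crossSum_conj, crossSum_eq_inner_of_cosetFunctions_left hϖ hε hB' hB hw hv f
    (fun g hg => ?_) g, inner_conj_symm]
  rw [crossSum_conj, h f hf g hg, inner_conj_symm]

theorem tendsto_crossSum_Ici {B B' : ℝ≥0∞} (hB : B ≠ ⊤) (hB' : B' ≠ ⊤)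
    {v w : Fin L × ℤ × ℕ → L2 K} (hv : BesselBound B v) (hw : BesselBound B' w) (f g : L2 K) :
    Tendsto (fun N : ℕ => crossSum (Set.Ici (-(N : ℤ))) v w f g) atTop
      (𝓝 (crossSum Set.univ v w f g)) := by
  have hs := (summable_cross hB hB' hv hw Set.univ f g).norm
  refine tendsto_tsum_of_dominated_convergence hs (fun i => ?_)
    (Eventually.of_forall fun N i => ?_)
  · refine tendsto_const_nhds.congr' ?_
    filter_upwards [eventually_ge_atTop i.2.1.natAbs] with N hN
    have : i.2.1 ∈ Set.Ici (-(N : ℤ)) := by rw [Set.mem_Ici]; omega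
    simp only [Set.indicator, Set.mem_ofPred_eq, this, Set.mem_univ, if_true]
  · by_cases hi : i.2.1 ∈ Set.Ici (-(N : ℤ))
    · simp only [Set.indicator, Set.mem_ofPred_eq, hi, Set.mem_univ, if_true, le_refl]
    · simp only [Set.indicator, Set.mem_ofPred_eq, hi, if_false, norm_zero, norm_nonneg]

end Density

/-! ### Affine duals are quasi-affine duals. -/

section AffineToQuasiAffine

open scoped ENNReal
open Filter Topology

variable {K : Type*} [Field K] [ValuativeRel K] [TopologicalSpace K] [IsNonarchimedeanLocalField K]
  {p : ℕ} [Fact p.Prime] [CharP K p] {c : ℕ} {ϖ : Kˣ} {ε : Fin c → 𝒪[K]}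
  [MeasurableSpace K] [BorelSpace K] {L : ℕ}

theorem quasiAffine_crossSum_eq_inner (hϖ : IsPrimeElement (ϖ : K)) (hε : IsResidueBasis p ε)
    {B B' : ℝ≥0∞} (hB : B ≠ ⊤) (hB' : B' ≠ ⊤) {Ψ Φ : Fin L → L2 K}
    (hΨ : BesselBound B (affineSystem p ϖ ε Ψ)) (hΦ : BesselBound B' (affineSystem p ϖ ε Φ))
    (h : ∀ f g, crossSum Set.univ (affineSystem p ϖ ε Ψ) (affineSystem p ϖ ε Φ) f g =
      inner ℂ g f) (f g : L2 K) :
    crossSum Set.univ (quasiAffineSystem p ϖ ε Ψ) (quasiAffineSystem p ϖ ε Φ) f g =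
      inner ℂ g f := by
  have hq : (residueCard K : ℂ) ≠ 0 := by
    exact_mod_cast (zero_lt_one.trans (one_lt_residueCard K)).ne'
  refine crossSum_eq_inner_of_cosetFunctions hϖ hε hB hB' (hΨ.quasiAffine hϖ hε)
    (hΦ.quasiAffine hϖ hε) ?_ f g
  rintro f ⟨b, hf⟩ g ⟨b', hg⟩
  -- Translations are unitary, so each full affine sum in the average is ⟨f, g⟩; the error is the
  -- averaged tail below -N.
  set err : ℕ → ℂ := fun N => ((residueCard K : ℂ) ^ N)⁻¹ *
    ∑ a ∈ Finset.range (residueCard K ^ N), crossSum (Set.Iio (-(N : ℤ)))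
      (affineSystem p ϖ ε Ψ) (affineSystem p ϖ ε Φ)
      (translationOp (-u p ϖ ε a) f) (translationOp (-u p ϖ ε a) g) with herr
  have h1 : ∀ N : ℕ, crossSum (Set.Ici (-(N : ℤ))) (quasiAffineSystem p ϖ ε Ψ)
      (quasiAffineSystem p ϖ ε Φ) f g = inner ℂ g f - err N := by
    intro N
    rw [crossSum_quasiAffine_eq_average hϖ hε hB hB' hΨ hΦ f g subset_rfl, herr, eq_sub_iff_add_eq,
      ← mul_add, ← Finset.sum_add_distrib]
    have : ∀ a ∈ Finset.range (residueCard K ^ N),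
        crossSum (Set.Ici (-(N : ℤ))) (affineSystem p ϖ ε Ψ) (affineSystem p ϖ ε Φ)
          (translationOp (-u p ϖ ε a) f) (translationOp (-u p ϖ ε a) g) +
        crossSum (Set.Iio (-(N : ℤ))) (affineSystem p ϖ ε Ψ) (affineSystem p ϖ ε Φ)
          (translationOp (-u p ϖ ε a) f) (translationOp (-u p ϖ ε a) g) = inner ℂ g f := by
      intro a _
      rw [← Set.compl_Ici, crossSum_add_compl hB hB' hΨ hΦ, h, inner_translationOp]
    rw [Finset.sum_congr rfl this, Finset.sum_const, Finset.card_range, nsmul_eq_mul, Nat.cast_pow,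
      inv_mul_cancel_left₀ (pow_ne_zero _ hq)]
  have h2 : Tendsto err atTop (𝓝 0) := by
    rw [tendsto_zero_iff_enorm_tendsto_zero]
    have h3 := (tendsto_average_energy hϖ hε hB hΨ hf).add
      (tendsto_average_energy hϖ hε hB' hΦ hg)
    rw [add_zero] at h3
    refine tendsto_of_tendsto_of_tendsto_of_le_of_le tendsto_const_nhds h3 (fun _ => zero_le)
      fun N => ?_
    simp only [herr]
    rw [enorm_mul, enorm_inv (pow_ne_zero _ hq), enorm_pow, ← mul_add, ← Finset.sum_add_distrib]
    have hn : ‖(residueCard K : ℂ)‖ₑ = residueCard K := by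
      rw [← ofReal_norm, Complex.norm_natCast, ENNReal.ofReal_natCast]
    rw [hn]
    gcongr
    exact (enorm_sum_le _ _).trans (Finset.sum_le_sum fun a _ => enorm_crossSum_le _ _ _ _ _)
  have h4 := tendsto_crossSum_Ici hB hB' (hΨ.quasiAffine hϖ hε) (hΦ.quasiAffine hϖ hε) f g
  refine tendsto_nhds_unique h4 ?_
  simp_rw [h1]
  simpa using (tendsto_const_nhds (x := (inner ℂ g f : ℂ))).sub h2

end AffineToQuasiAffine

/-! ### Quasi-affine duals are affine duals. -/

section QuasiAffineToAffine

open scoped ENNReal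
open Filter Topology

variable {K : Type*} [Field K] [ValuativeRel K] [TopologicalSpace K] [IsNonarchimedeanLocalField K]
  {p : ℕ} [Fact p.Prime] [CharP K p] {c : ℕ} {ϖ : Kˣ} {ε : Fin c → 𝒪[K]}
  [MeasurableSpace K] [BorelSpace K] {L : ℕ}

/-- The affine system is dilation covariant: δ_N sends the element of scale j to that of scale j + N
with the same k. The quasi-affine system lacks this at negative scales. -/
theorem crossSum_affine_dilate (hϖ : IsPrimeElement (ϖ : K)) (hε : IsResidueBasis p ε)
    (Ψ Φ : Fin L → L2 K) (f g : L2 K) (N : ℕ) :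
    crossSum (Set.Ici (-(N : ℤ))) (affineSystem p ϖ ε Ψ) (affineSystem p ϖ ε Φ) f g =
      crossSum (Set.Ici 0) (affineSystem p ϖ ε Ψ) (affineSystem p ϖ ε Φ)
        (dilationOp ϖ N f) (dilationOp ϖ N g) := by
  have hp := (Fact.out : p.Prime).pos
  let e : Fin L × ℤ × ℕ ≃ Fin L × ℤ × ℕ :=
    (Equiv.refl _).prodCongr ((Equiv.addLeft (N : ℤ)).prodCongr (Equiv.refl _))
  have hsys : ∀ (Ψ : Fin L → L2 K) i, affineSystem p ϖ ε Ψ (e i) =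
      dilationOp ϖ N (affineSystem p ϖ ε Ψ i) := by
    intro Ψ i
    rw [affineSystem, affineSystem, affineElt, affineElt, dilationOp_dilationOp hp hϖ hε]
    rfl
  symm
  rw [crossSum, crossSum, ← e.tsum_eq]
  refine tsum_congr fun i => ?_
  have hmem : (e i).2.1 ∈ Set.Ici (0 : ℤ) ↔ i.2.1 ∈ Set.Ici (-(N : ℤ)) := by
    change (0 : ℤ) ≤ N + i.2.1 ↔ -(N : ℤ) ≤ i.2.1
    omega
  by_cases hi : i.2.1 ∈ Set.Ici (-(N : ℤ))
  · simp only [Set.indicator, Set.mem_ofPred_eq, hmem, hi, if_true, hsys,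
      inner_dilationOp hp hϖ hε]
  · simp only [Set.indicator, Set.mem_ofPred_eq, hmem, hi, if_false]

theorem crossSum_quasiAffine_Ici_zero (Ψ Φ : Fin L → L2 K) (f g : L2 K) :
    crossSum (Set.Ici 0) (quasiAffineSystem p ϖ ε Ψ) (quasiAffineSystem p ϖ ε Φ) f g =
      crossSum (Set.Ici 0) (affineSystem p ϖ ε Ψ) (affineSystem p ϖ ε Φ) f g := by
  rw [crossSum, crossSum]
  refine tsum_congr fun i => ?_
  by_cases hi : (0 : ℤ) ≤ i.2.1
  · simp only [Set.indicator, Set.mem_ofPred_eq, Set.mem_Ici, hi, if_true, quasiAffineSystem,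
      affineSystem, quasiAffineElt, affineElt]
  · simp only [Set.indicator, Set.mem_ofPred_eq, Set.mem_Ici, hi, if_false]

theorem VanishesOff.exists_prime_ball (hϖ : IsPrimeElement (ϖ : K))
    {f : L2 K} {b : ℕ} (hf : VanishesOff {x | valuation K (x - u p ϖ ε b) ≤ 1} f) :
    ∃ M : ℕ, VanishesOff {x | valuation K (((ϖ ^ (M : ℤ) : Kˣ) : K) * x) ≤ 1} f := by
  obtain ⟨M, hM⟩ := exists_pow_mul_le_one hϖ (u p ϖ ε b)
  refine ⟨M, hf.mono fun x hx => ?_⟩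
  have h1 : valuation K ((ϖ : K) ^ M * (x - u p ϖ ε b)) ≤ 1 := by
    rw [map_mul, map_pow]
    exact mul_le_one' (pow_le_one₀ zero_le hϖ.1.le) hx
  have h2 := Valuation.map_add_le (valuation K) h1 hM
  rw [← mul_add, sub_add_cancel] at h2
  simpa using h2

/-- The set on which the generator is integrated in the term of index `(j, k)` against a function
supported in the ball of level `n`. -/
def dilateCell (p : ℕ) {c : ℕ} (ϖ : Kˣ) (ε : Fin c → 𝒪[K]) (n j : ℤ) (k : ℕ) : Set K :=
  {x | valuation K (((ϖ ^ n : Kˣ) : K) * (((ϖ ^ j : Kˣ) : K) * x + u p ϖ ε k)) ≤ 1}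

theorem measurableSet_dilateCell (n j : ℤ) (k : ℕ) :
    MeasurableSet (dilateCell p ϖ ε n j k) := by
  simpa only [dilateCell, mul_add, ← mul_assoc] using measurableSet_affine_integers
    (((ϖ ^ n : Kˣ) : K) * ((ϖ ^ j : Kˣ) : K)) (((ϖ ^ n : Kˣ) : K) * u p ϖ ε k)

theorem dilateCell_mono (hϖ : IsPrimeElement (ϖ : K)) {m n : ℤ} (h : m ≤ n) (j : ℤ) (k : ℕ) :
    dilateCell p ϖ ε m j k ⊆ dilateCell p ϖ ε n j k := by
  intro x hx
  obtain ⟨d, rfl⟩ := Int.le.dest h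
  simp only [dilateCell, Set.mem_ofPred_eq] at hx ⊢
  rw [zpow_add, mul_comm (ϖ ^ m), Units.val_mul, mul_assoc, map_mul, valuation_zpow, zpow_natCast]
  exact mul_le_one' (pow_le_one₀ zero_le hϖ.1.le) hx

/-- At level 0 the cells are disjoint in k, since ϖ^j x + u(k) ∈ 𝔇 for at most one k. This supplies
the dominating series. -/
theorem tsum_mass_dilateCell_le (hϖ : IsPrimeElement (ϖ : K)) (hε : IsResidueBasis p ε)
    (ψ : L2 K) (j : ℤ) : ∑' k, mass ψ (dilateCell p ϖ ε 0 j k) ≤ ‖ψ‖ₑ ^ 2 := by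
  rw [← mass_univ]
  refine tsum_measure_le_measure_univ
    (fun k => (measurableSet_dilateCell 0 j k).nullMeasurableSet) fun k k' hne => ?_
  refine Disjoint.aedisjoint (Set.disjoint_left.mpr fun x hx hx' => hne ?_)
  refine eq_of_valuation_u_sub_le_one (Fact.out : p.Prime).pos hϖ hε ?_
  simp only [dilateCell, Set.mem_ofPred_eq, zpow_zero, Units.val_one, one_mul] at hx hx'
  have := Valuation.map_sub_le (valuation K) hx hx'
  rwa [add_sub_add_left_eq_sub] at this

/-- The cells decrease in N and their intersection lies in {-ϖ^(-j) u(k)}, a null set; the finite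
measure |ψ|² dx is continuous from above. -/
theorem tendsto_mass_dilateCell (hϖ : IsPrimeElement (ϖ : K)) (hε : IsResidueBasis p ε)
    (ψ : L2 K) (M : ℕ) (j : ℤ) (k : ℕ) :
    Tendsto (fun N : ℕ => mass ψ (dilateCell p ϖ ε ((M : ℤ) - N) j k)) atTop (𝓝 0) := by
  have h := tendsto_measure_iInter_atTop (μ := mass ψ)
    (s := fun N : ℕ => dilateCell p ϖ ε ((M : ℤ) - N) j k)
    (fun N => (measurableSet_dilateCell _ j k).nullMeasurableSet)
    (fun N N' hN => dilateCell_mono hϖ (by omega) j k) ⟨0, measure_ne_top _ _⟩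
  have hsub : ⋂ N : ℕ, dilateCell p ϖ ε ((M : ℤ) - N) j k ⊆
      {((ϖ ^ (-j) : Kˣ) : K) * (-u p ϖ ε k)} := by
    intro x hx
    rw [Set.mem_iInter] at hx
    have h0 : ((ϖ ^ j : Kˣ) : K) * x + u p ϖ ε k = 0 := by
      by_contra hne
      set y := ((ϖ ^ j : Kˣ) : K) * x + u p ϖ ε k with hy
      obtain ⟨n, hn⟩ := exists_pow_lt_valuation hϖ ((valuation K).ne_zero_iff.mpr hne)
      have h1 := hx (M + n)
      simp only [dilateCell, Set.mem_ofPred_eq] at h1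
      have e : (M : ℤ) - ((M + n : ℕ) : ℤ) = -(n : ℤ) := by push_cast; ring
      rw [e, map_mul, valuation_zpow, zpow_neg, zpow_natCast] at h1
      have h2 := mul_le_mul_right h1 (valuation K (ϖ : K) ^ n)
      rw [mul_inv_cancel_left₀ (pow_ne_zero _ (valuation_unit_pos ϖ).ne'), mul_one] at h2
      exact absurd hn (not_lt.mpr h2)
    rw [Set.mem_singleton_iff, ← eq_neg_of_add_eq_zero_left h0, ← mul_assoc, ← Units.val_mul,
      ← zpow_add]
    simp
  have hz : mass ψ (⋂ N : ℕ, dilateCell p ϖ ε ((M : ℤ) - N) j k) = 0 :=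
    measure_mono_null hsub
      (mass_absolutelyContinuous ψ (haar_singleton (Fact.out : p.Prime).pos hϖ hε _))
  rw [hz] at h
  exact h

theorem enorm_dilationOp (hp : 0 < p) (hϖ : IsPrimeElement (ϖ : K)) (hε : IsResidueBasis p ε)
    (j : ℤ) (f : L2 K) : ‖dilationOp ϖ j f‖ₑ = ‖f‖ₑ := by
  rw [← ofReal_norm, norm_dilationOp hp hϖ hε, ofReal_norm]

theorem enorm_inner_quasiAffineElt_sq_le (hϖ : IsPrimeElement (ϖ : K))
    (hε : IsResidueBasis p ε) {f : L2 K} {M : ℕ}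
    (hf : VanishesOff {x | valuation K (((ϖ ^ (M : ℤ) : Kˣ) : K) * x) ≤ 1} f) (ψ : L2 K) {j : ℤ}
    (hj : j < 0) (k N : ℕ) :
    ‖(inner ℂ (quasiAffineElt p ϖ ε ψ j k) (dilationOp ϖ N f) : ℂ)‖ₑ ^ 2 ≤
      ‖f‖ₑ ^ 2 *
        ((residueCard K : ℝ≥0∞) ^ j * mass ψ (dilateCell p ϖ ε ((M : ℤ) - N) j k)) := by
  have hp := (Fact.out : p.Prime).pos
  have hS : MeasurableSet {x : K | valuation K (((ϖ ^ ((M : ℤ) - N) : Kˣ) : K) * x) ≤ 1} := by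
    simpa using measurableSet_affine_integers ((ϖ ^ ((M : ℤ) - N) : Kˣ) : K) 0
  have hS' : MeasurableSet {x : K | x + u p ϖ ε k ∈
      {x : K | valuation K (((ϖ ^ ((M : ℤ) - N) : Kˣ) : K) * x) ≤ 1}} :=
    (measurable_add_const _) hS
  have hv : VanishesOff {x : K | valuation K (((ϖ ^ ((M : ℤ) - N) : Kˣ) : K) * x) ≤ 1}
      (dilationOp ϖ N f) := by
    refine (hf.dilationOp hp hϖ hε N).mono fun x hx => ?_
    have hx : valuation K (((ϖ ^ (M : ℤ) : Kˣ) : K) * (((ϖ ^ (-(N : ℤ)) : Kˣ) : K) * x)) ≤ 1 := hx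
    rwa [← mul_assoc, ← Units.val_mul, ← zpow_add] at hx
  rw [quasiAffineElt, if_neg (not_le.mpr hj), inner_smul_left, enorm_mul, mul_pow,
    RCLike.enorm_conj, enorm_rpow_half_sq, mul_left_comm]
  gcongr
  refine (enorm_inner_sq_le_mass hS hv _).trans_eq ?_
  rw [enorm_dilationOp hp hϖ hε, mass_translationOp _ _ hS, mass_dilationOp hp hϖ hε _ _ hS']
  rfl

theorem tsum_negative_scales_lt_top :
    ∑' j : ℤ, Set.indicator (Set.Iio 0) (fun j : ℤ => (residueCard K : ℝ≥0∞) ^ j) j < ⊤ := by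
  have hinj : Function.Injective Int.negSucc := fun a b h => by simpa using h
  rw [← hinj.tsum_eq]
  · have h : ∀ m : ℕ, Set.indicator (Set.Iio 0) (fun j : ℤ => (residueCard K : ℝ≥0∞) ^ j)
        (Int.negSucc m) = ((residueCard K : ℝ≥0∞)⁻¹) ^ (m + 1) := by
      intro m
      rw [Set.indicator_of_mem (Set.mem_Iio.mpr (Int.negSucc_lt_zero m)), Int.negSucc_eq,
        ENNReal.zpow_neg, ← Int.natCast_succ, zpow_natCast, ENNReal.inv_pow]
    simp_rw [h]
    rw [ENNReal.tsum_geometric_add_one]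
    have hlt : (residueCard K : ℝ≥0∞)⁻¹ < 1 := by
      rw [ENNReal.inv_lt_one]
      exact_mod_cast one_lt_residueCard K
    exact ENNReal.mul_lt_top (hlt.trans ENNReal.one_lt_top)
      (ENNReal.inv_lt_top.mpr (tsub_pos_of_lt hlt))
  · intro j hj
    have hj0 : j < 0 := by
      by_contra h
      simp [h] at hj
    exact ⟨(-j - 1).toNat, by rw [Int.negSucc_eq]; omega⟩

/-- The quasi-affine energies at negative scales of `δ_N f` vanish in the limit. -/
theorem tendsto_energy_quasiAffine_dilationOp (hϖ : IsPrimeElement (ϖ : K))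
    (hε : IsResidueBasis p ε) (Ψ : Fin L → L2 K) {f : L2 K} {b : ℕ}
    (hf : VanishesOff {x | valuation K (x - u p ϖ ε b) ≤ 1} f) :
    Tendsto (fun N : ℕ => energy (Set.Iio 0) (quasiAffineSystem p ϖ ε Ψ) (dilationOp ϖ N f))
      atTop (𝓝 0) := by
  obtain ⟨M, hM⟩ := hf.exists_prime_ball hϖ
  set F : L2 K → ℤ → ℤ × ℕ → ℝ≥0∞ := fun ψ n => Set.indicator {x | x.1 ∈ Set.Iio 0} fun x =>
    (residueCard K : ℝ≥0∞) ^ x.1 * mass ψ (dilateCell p ϖ ε n x.1 x.2) with hF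
  have hlim : ∀ ψ : L2 K, Tendsto (fun N : ℕ => ∑' x, F ψ ((M : ℤ) - N) x) atTop (𝓝 0) := by
    intro ψ
    have hq := residueCard_ne_zero K
    have hq' : (residueCard K : ℝ≥0∞) ≠ ⊤ := ENNReal.natCast_ne_top _
    have hfin : ∑' x, F ψ 0 x ≠ ⊤ := by
      refine ne_top_of_le_ne_top (ENNReal.mul_lt_top (tsum_negative_scales_lt_top (K := K))
        (ENNReal.pow_lt_top (enorm_lt_top (x := ψ)) (n := 2))).ne ?_
      rw [ENNReal.tsum_prod', ← ENNReal.tsum_mul_right]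
      refine ENNReal.tsum_le_tsum fun j => ?_
      by_cases hj : j ∈ Set.Iio (0 : ℤ)
      · simp only [hF, Set.indicator, Set.mem_ofPred_eq, hj, if_true]
        rw [ENNReal.tsum_mul_left]
        gcongr
        exact tsum_mass_dilateCell_le hϖ hε ψ j
      · simp only [hF, Set.indicator, Set.mem_ofPred_eq, hj, if_false, tsum_zero, zero_le]
    -- Series become integrals against counting measure, so that dominated convergence in [0, ∞]
    -- applies. The majorant is the level-0 series, valid once N ≥ M.
    simp_rw [← lintegral_count]
    rw [← lintegral_zero (μ := (Measure.count : Measure (ℤ × ℕ)))]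
    refine tendsto_lintegral_filter_of_dominated_convergence (F ψ 0)
      (Eventually.of_forall fun _ => .of_discrete) ?_ (by rwa [lintegral_count]) ?_
    · filter_upwards [eventually_ge_atTop M] with N hN
      refine Eventually.of_forall fun x => ?_
      refine Set.indicator_le_indicator (mul_le_mul_right (measure_mono ?_) _)
      exact dilateCell_mono hϖ (by omega) _ _
    · refine Eventually.of_forall fun x => ?_
      by_cases hx : x.1 ∈ Set.Iio (0 : ℤ)
      · simp only [hF, Set.indicator, Set.mem_ofPred_eq, hx, if_true]
        have := ENNReal.Tendsto.const_mul (tendsto_mass_dilateCell hϖ hε ψ M x.1 x.2)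
          (Or.inr (ENNReal.zpow_ne_top hq hq' x.1))
        simpa using this
      · simp only [hF, Set.indicator, Set.mem_ofPred_eq, hx, if_false, tendsto_const_nhds]
  have hsum := ENNReal.Tendsto.const_mul (a := ‖f‖ₑ ^ 2)
    (tendsto_finsetSum (Finset.univ : Finset (Fin L)) fun l _ => hlim (Ψ l))
    (Or.inr (ENNReal.pow_ne_top enorm_ne_top))
  rw [Finset.sum_const_zero, mul_zero] at hsum
  refine tendsto_of_tendsto_of_tendsto_of_le_of_le tendsto_const_nhds hsum (fun _ => zero_le)
    fun N => ?_
  simp only [energy_eq_sum, Finset.mul_sum]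
  refine Finset.sum_le_sum fun l _ => ?_
  rw [← ENNReal.tsum_mul_left]
  refine ENNReal.tsum_le_tsum fun x => ?_
  by_cases hx : x.1 ∈ Set.Iio (0 : ℤ)
  · simp only [hF, Set.indicator, Set.mem_ofPred_eq, hx, if_true]
    exact enorm_inner_quasiAffineElt_sq_le hϖ hε hM (Ψ l) hx x.2 N
  · simp only [Set.indicator, Set.mem_ofPred_eq, hx, if_false, zero_le]

theorem affine_crossSum_eq_inner (hϖ : IsPrimeElement (ϖ : K)) (hε : IsResidueBasis p ε)
    {B B' : ℝ≥0∞} (hB : B ≠ ⊤) (hB' : B' ≠ ⊤) {Ψ Φ : Fin L → L2 K}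
    (hΨ : BesselBound B (affineSystem p ϖ ε Ψ)) (hΦ : BesselBound B' (affineSystem p ϖ ε Φ))
    (h : ∀ f g, crossSum Set.univ (quasiAffineSystem p ϖ ε Ψ) (quasiAffineSystem p ϖ ε Φ) f g =
      inner ℂ g f) (f g : L2 K) :
    crossSum Set.univ (affineSystem p ϖ ε Ψ) (affineSystem p ϖ ε Φ) f g = inner ℂ g f := by
  have hp := (Fact.out : p.Prime).pos
  refine crossSum_eq_inner_of_cosetFunctions hϖ hε hB hB' hΨ hΦ ?_ f g
  rintro f ⟨b, hf⟩ g ⟨b', hg⟩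
  -- The quasi-affine identity is applied to δ_N f and δ_N g; its part j ≥ 0 is the affine sum over
  -- j ≥ -N for f and g, and the rest is the error.
  set err : ℕ → ℂ := fun N => crossSum (Set.Iio 0) (quasiAffineSystem p ϖ ε Ψ)
    (quasiAffineSystem p ϖ ε Φ) (dilationOp ϖ N f) (dilationOp ϖ N g) with herr
  have h1 : ∀ N : ℕ, crossSum (Set.Ici (-(N : ℤ))) (affineSystem p ϖ ε Ψ)
      (affineSystem p ϖ ε Φ) f g = inner ℂ g f - err N := by
    intro N
    rw [crossSum_affine_dilate hϖ hε, ← crossSum_quasiAffine_Ici_zero, herr,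
      eq_sub_iff_add_eq, ← Set.compl_Ici, crossSum_add_compl hB hB' (hΨ.quasiAffine hϖ hε)
      (hΦ.quasiAffine hϖ hε), h, inner_dilationOp hp hϖ hε]
  have h2 : Tendsto err atTop (𝓝 0) := by
    rw [tendsto_zero_iff_enorm_tendsto_zero]
    have h3 := (tendsto_energy_quasiAffine_dilationOp hϖ hε Ψ hf).add
      (tendsto_energy_quasiAffine_dilationOp hϖ hε Φ hg)
    rw [add_zero] at h3
    exact tendsto_of_tendsto_of_tendsto_of_le_of_le tendsto_const_nhds h3 (fun _ => zero_le)
      fun N => enorm_crossSum_le _ _ _ _ _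
  refine tendsto_nhds_unique (tendsto_crossSum_Ici hB hB' hΨ hΦ f g) ?_
  simp_rw [h1]
  simpa using (tendsto_const_nhds (x := (inner ℂ g f : ℂ))).sub h2

end QuasiAffineToAffine

end AffineDuals

/-! ### The equivalence of affine and quasi-affine duality. -/

theorem mainTheorem3 {K : Type*} [Field K] [ValuativeRel K] [TopologicalSpace K]
    [IsNonarchimedeanLocalField K] [MeasurableSpace K] [BorelSpace K]
    (p : ℕ) [Fact p.Prime] [CharP K p]
    (ϖ : Kˣ) (hϖ : AffineDuals.IsPrimeElement (ϖ : K))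
    (c : ℕ) [NeZero c] (ε : Fin c → 𝒪[K]) (hε₀ : ε 0 = 1)
    (hε : AffineDuals.IsResidueBasis p ε)
    (L : ℕ) (Ψ Φ : Fin L → AffineDuals.L2 K)
    (hΨ : AffineDuals.IsAffineBessel p ϖ ε Ψ) :
    AffineDuals.IsAffineDual p ϖ ε Ψ Φ ↔ AffineDuals.IsQuasiAffineDual p ϖ ε Ψ Φ := by
  refine and_congr_right fun _ => and_congr_right fun hΦ => ?_
  obtain ⟨B, hB, hΨ⟩ := (AffineDuals.isAffineBessel_iff Ψ).mp hΨ
  obtain ⟨B', hB', hΦ⟩ := (AffineDuals.isAffineBessel_iff Φ).mp hΦ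
  -- Under the two Bessel bounds both series converge unconditionally, so each duality is only a
  -- statement about the value of a sum.
  have hA := AffineDuals.hasSum_cross hB hB' hΨ hΦ
  have hQ := AffineDuals.hasSum_cross hB hB' (hΨ.quasiAffine hϖ hε) (hΦ.quasiAffine hϖ hε)
  constructor
  · intro h f g
    have := hQ f g
    rwa [AffineDuals.quasiAffine_crossSum_eq_inner hϖ hε hB hB' hΨ hΦ
      (fun f g => (hA f g).unique (h f g))] at this
  · intro h f g
    have := hA f g
    rwa [AffineDuals.affine_crossSum_eq_inner hϖ hε hB hB' hΨ hΦ
      (fun f g => (hQ f g).unique (h f g))] at this
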